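/- Let $F$ be a germ at $0$ of a holomorphic diffeomorphism of $\mathbb{C}^n$ with $F(0)=0$ and diagonal differential $dF_0=\mathrm{diag}(\lambda_1,\ldots,\lambda_n)$. A resonance is a pair $(j,l)$ with $1\le j\le n$, $l\in\mathbb{N}^n$, $|l|\ge 2$ and $\lambda_j=\lambda^l:=\lambda_1^{l_1}\cdots\lambda_n^{l_n}$; the corresponding monomial $z^l$ in the $j$-th component of a formal map is called resonant. Let $1\le m\le n$ and suppose that $F$ is one-resonant with respect to $\lambda_1,\ldots,\lambda_m$ with index of resonance $\alpha$: that is, $\alpha=(\alpha_1,\ldots,\alpha_m,0,\ldots,0)\in\mathbb{N}^n$, $\alpha\neq 0$, and the resonances $(j,l)$ with $j\le m$ are precisely the pairs $(j,k\alpha+e_j)$ with $1\le j\le m$ and $k\ge 1$ an integer, $e_j$ being the $j$-th unit vector. Suppose moreover that $F$ is non-degenerate with respect to $\lambda_1,\ldots,\lambda_m$: that is, $F$ is formally conjugate to a formal map $G$ with $G(0)=0$ and linear part $\mathrm{diag}(\lambda_1,\ldots,\lambda_n)$ (possibly $G=F$) such that $$G_j(z)=\lambda_jz_j+c_jz^{r\alpha}z_j+O(|z|^{r|\alpha|+2}),\qquad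 j=1,\ldots,m,$$ for some integer $r\ge1$ and some $c=(c_1,\ldots,c_m)\in\mathbb{C}^m\setminus\{0\}$ with $\sum_{j=1}^m c_j\alpha_j/\lambda_j\neq0$. (Two formal maps $A,B$ without constant term are formally conjugate if $\Phi\circ A=B\circ\Phi$ for a formal map $\Phi$ without constant term and with invertible linear part; a germ is identified with its Taylor series.) Then there exist an integer $k\ge 1$ and numbers $\mu,a_1,\ldots,a_m\in\mathbb{C}$ such that $F$ is formally conjugate to a formal map $\hat F=(\hat F_1,\ldots,\hat F_n)$ with $$\hat F_j(z)=\lambda_jz_j+a_jz^{k\alpha}z_j+\mu\,\alpha_j\,\overline{\lambda_j}^{\,-1}z^{2k\alpha}z_j,\qquad j=1,\ldots,m,$$ and such that for $j=m+1,\ldots,n$ the component $\hat F_j$ is the sum of $\lambda_jz_j$ and of a (possibly infinite) formal sum of resonant monomials, with coefficients. -/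

import Mathlib

open MvPowerSeries Topology
open scoped ComplexConjugate

namespace OneResonant

/-- `F` represents a germ of holomorphic diffeomorphism of `ℂⁿ` fixing the origin:
it is holomorphic near `0`, fixes `0`, and has a holomorphic inverse germ at `0`. -/
def IsDiffGerm {n : ℕ} (F : (Fin n → ℂ) → (Fin n → ℂ)) : Prop :=
  AnalyticAt ℂ F 0 ∧ F 0 = 0 ∧
    ∃ G : (Fin n → ℂ) → (Fin n → ℂ), AnalyticAt ℂ G 0 ∧ G 0 = 0 ∧
      (∀ᶠ z in 𝓝 (0 : Fin n → ℂ), G (F z) = z) ∧ (∀ᶠ z in 𝓝 (0 : Fin n → ℂ), F (G z) = z)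

/-- The differential of `F` at `0` is the diagonal map `diag(lam)`. -/
def HasDiagonalDifferential {n : ℕ} (F : (Fin n → ℂ) → (Fin n → ℂ)) (lam : Fin n → ℂ) : Prop :=
  ∀ v j, fderiv ℂ F 0 v j = lam j * v j

/-- `(j, l)` is a resonance of `lam`: `|l| ≥ 2` and `lam_j = lam ^ l`. -/
def IsResonance {n : ℕ} (lam : Fin n → ℂ) (j : Fin n) (l : Fin n →₀ ℕ) : Prop :=
  2 ≤ l.degree ∧ lam j = ∏ i, lam i ^ l i

/-- A germ with eigenvalues `lam` is one-resonant with respect to the first `m` of them, with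
index of resonance `α`. -/
def IsOneResonant {n : ℕ} (lam : Fin n → ℂ) (m : ℕ) (α : Fin n →₀ ℕ) : Prop :=
  α ≠ 0 ∧ (∀ i : Fin n, m ≤ (i : ℕ) → α i = 0) ∧
    ∀ j : Fin n, (j : ℕ) < m → ∀ l : Fin n →₀ ℕ,
      IsResonance lam j l ↔ ∃ k : ℕ, 1 ≤ k ∧ l = k • α + Finsupp.single j 1

/-- Formal maps: `n`-tuples of formal power series in `n` variables. -/
abbrev FormalMap (n : ℕ) : Type := Fin n → MvPowerSeries (Fin n) ℂ

/-- The partial derivative `∂f/∂z_i`. -/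
noncomputable def partialDeriv {n : ℕ} (i : Fin n) (f : (Fin n → ℂ) → ℂ) : (Fin n → ℂ) → ℂ :=
  fun z => fderiv ℂ f z (Pi.single i 1)

/-- `∂^l f = ∂_1^{l_1} ⋯ ∂_n^{l_n} f`. -/
noncomputable def iteratedPartialDeriv {n : ℕ} (l : Fin n →₀ ℕ) (f : (Fin n → ℂ) → ℂ) :
    (Fin n → ℂ) → ℂ :=
  (List.finRange n).foldr (fun i g => (partialDeriv i)^[l i] g) f

/-- The Taylor expansion of `F` at `0`. -/
noncomputable def taylor {n : ℕ} (F : (Fin n → ℂ) → (Fin n → ℂ)) : FormalMap n :=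
  fun j l => iteratedPartialDeriv l (fun z => F z j) 0 / ∏ i, ((l i).factorial : ℂ)

/-- Composition `A ∘ B` of formal maps (meaningful when `B` has no constant term). -/
noncomputable def FormalMap.comp {n : ℕ} (A B : FormalMap n) : FormalMap n :=
  fun j => (A j).subst B

/-- The matrix of the linear part of a formal map. -/
noncomputable def FormalMap.linearPart {n : ℕ} (A : FormalMap n) : Matrix (Fin n) (Fin n) ℂ :=
  Matrix.of fun j i => coeff (Finsupp.single i 1) (A j)

/-- Formal diffeomorphisms of `(ℂⁿ, 0)`: no constant term and invertible linear part. -/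
def FormalMap.IsFormalDiffeo {n : ℕ} (A : FormalMap n) : Prop :=
  (∀ j, constantCoeff (A j) = 0) ∧ IsUnit A.linearPart

/-- `A` and `B` are conjugate by a formal diffeomorphism `Φ`: `Φ ∘ A = B ∘ Φ`,
i.e. `B = Φ ∘ A ∘ Φ⁻¹`. -/
def FormallyConjugate {n : ℕ} (A B : FormalMap n) : Prop :=
  ∃ Φ : FormalMap n, Φ.IsFormalDiffeo ∧ Φ.comp A = B.comp Φ

/-- `G` has no constant term, linear part `diag(lam)`, and
`G_j(z) = lam_j z_j + a_j z^{kα} z_j + O(|z|^{k|α|+2})` for `j = 1, …, m`. -/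
def HasLeadingForm {n m : ℕ} (hmn : m ≤ n) (lam : Fin n → ℂ) (α : Fin n →₀ ℕ)
    (k : ℕ) (a : Fin m → ℂ) (G : FormalMap n) : Prop :=
  (∀ j, constantCoeff (G j) = 0) ∧ G.linearPart = Matrix.diagonal lam ∧
    ∀ j : Fin m, ∀ l : Fin n →₀ ℕ, l.degree < k * α.degree + 2 →
      coeff l (G (Fin.castLE hmn j)) =
        coeff l (C (lam (Fin.castLE hmn j)) * X (Fin.castLE hmn j)
          + C (a j) * monomial (k • α) 1 * X (Fin.castLE hmn j) : MvPowerSeries (Fin n) ℂ)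

/-- Non-degeneracy with respect to the first `m` eigenvalues, for index of resonance `α`:
the germ is, up to formal conjugation, of the form
`lam_j z_j + a_j z^{kα} z_j + O(|z|^{k|α|+2})`, `j = 1, …, m`, with `k ≥ 1`, `a ≠ 0` and
`Λ = ∑_{j ≤ m} a_j α_j / lam_j ≠ 0`. -/
def IsNonDegenerate {n m : ℕ} (hmn : m ≤ n) (F : (Fin n → ℂ) → (Fin n → ℂ)) (lam : Fin n → ℂ)
    (α : Fin n →₀ ℕ) : Prop :=
  ∃ (G : FormalMap n) (k : ℕ) (a : Fin m → ℂ),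
    FormallyConjugate (taylor F) G ∧ 1 ≤ k ∧ a ≠ 0 ∧ HasLeadingForm hmn lam α k a G ∧
      ∑ j : Fin m, a j * (α (Fin.castLE hmn j) : ℂ) / lam (Fin.castLE hmn j) ≠ 0

/-- The `j`-th component of `G` is `lam_j z_j` plus (possibly infinitely many) resonant
monomials. -/
def HasOnlyResonantMonomials {n : ℕ} (lam : Fin n → ℂ) (G : FormalMap n) (j : Fin n) : Prop :=
  coeff (Finsupp.single j 1) (G j) = lam j ∧
    ∀ l : Fin n →₀ ℕ, coeff l (G j) ≠ 0 → l = Finsupp.single j 1 ∨ IsResonance lam j l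

end OneResonant

/-! Poincaré–Dulac (`exists_poincareDulac`) conjugates `G` to some `H` with only resonant nonlinear
monomials. For `j ≤ m` one-resonance then forces `H_j = z_j h_j(u)` with `u = z^α`, and the leading
terms survive (`sub_mem_ordIdeal_of_leading`): `h_j = λ_j + c_j T^r + O(T^(r+1))`.

Next conjugate by `z_j ↦ z_j p_j(u)` for `j ≤ m`, fixing the other coordinates. For `j ≤ m` the
equation involves `u` alone: it says that one-variable series, the `conjDefect`, vanish. As `λ^α =
1`, `H` acts on `u` by `T ↦ T(1 + ΛT^r + ⋯)` with `Λ = ∑ c_i α_i / λ_i`. Adding `δ_j T^d` to `p_j`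
changes the defect first in degree `d + r`, by `λ_j dΛδ_j - r c_j S` with `S = ∑ α_i δ_i`. Pairing
with `α_j / λ_j` gives `(d - r)ΛS`, so this system is invertible unless `d = r`. There the cokernel
is a line, and `μ` fills it: with `β_j = α_j / conj λ_j`, the pairing of `β` is `∑ α_j² / |λ_j|² >
0`.

For `j > m` the new component is `H_j ∘ Ψ⁻¹`. Since `u` is invariant under `diag(λ)`, `Ψ` commutes
with `diag(λ)`, and so only resonant monomials occur. -/

namespace OneResonant

/-- Successive approximation: a predicate `P d` that depends only on the values in degree `< d`
and can always be improved by changing the values in degree `≥ d` has a common solution. -/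
theorem exists_forall_of_approx {I β : Type*} (deg : I → ℕ) (P : ℕ → (I → β) → Prop)
    (hcongr : ∀ d x y, P d x → (∀ i, deg i < d → x i = y i) → P d y)
    (hstep : ∀ d x, P d x → ∃ y, (∀ i, deg i < d → x i = y i) ∧ P (d + 1) y)
    (x₀ : I → β) (h₀ : P 0 x₀) : ∃ x, ∀ d, P d x := by
  choose! f hf using hstep
  let s : ℕ → I → β := fun d => Nat.rec x₀ (fun d x => f d x) d
  have hs : ∀ d, P d (s d) := by
    intro d
    induction d with
    | zero => exact h₀
    | succ d ih => exact (hf d _ ih).2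
  have hagree : ∀ d e, d ≤ e → ∀ i, deg i < d → s d i = s e i := by
    intro d e hde
    induction e, hde using Nat.le_induction with
    | base => intro i _; rfl
    | succ e he ih =>
      intro i hi
      rw [ih i hi]
      exact (hf e _ (hs e)).1 i (hi.trans_le he)
  refine ⟨fun i => s (deg i + 1) i, fun d => hcongr d (s d) _ (hs d) fun i hi => ?_⟩
  exact (hagree (deg i + 1) d hi i (Nat.lt_succ_self _)).symm

/-! ### Order filtration on power series and its behaviour under substitution -/

section OrdIdeal

variable {σ τ R : Type*} [CommRing R]

/-- The ideal of power series all of whose terms have degree at least `d`. -/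
def ordIdeal (σ R : Type*) [CommRing R] (d : ℕ) : Ideal (MvPowerSeries σ R) where
  carrier := {f | ∀ l : σ →₀ ℕ, l.degree < d → coeff l f = 0}
  zero_mem' := by intro l _; simp
  add_mem' := by
    intro f g hf hg l hl
    rw [map_add, hf l hl, hg l hl, add_zero]
  smul_mem' := by
    classical
    intro c f hf l hl
    rw [smul_eq_mul, coeff_mul]
    refine Finset.sum_eq_zero fun p hp => ?_
    have := Finset.HasAntidiagonal.mem_antidiagonal.1 hp
    rw [hf p.2, mul_zero]
    rw [← this, map_add] at hl
    omega

theorem mem_ordIdeal {d : ℕ} {f : MvPowerSeries σ R} :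
    f ∈ ordIdeal σ R d ↔ ∀ l : σ →₀ ℕ, l.degree < d → coeff l f = 0 := Iff.rfl

theorem ordIdeal_anti {d e : ℕ} (h : d ≤ e) {f : MvPowerSeries σ R} (hf : f ∈ ordIdeal σ R e) :
    f ∈ ordIdeal σ R d := fun l hl => hf l (hl.trans_le h)

theorem mem_ordIdeal_one {f : MvPowerSeries σ R} :
    f ∈ ordIdeal σ R 1 ↔ constantCoeff f = 0 := by
  rw [mem_ordIdeal, ← coeff_zero_eq_constantCoeff_apply]
  constructor
  · intro h; exact h 0 (by simp)
  · intro h l hl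
    have : l = 0 := by rwa [Nat.lt_one_iff, Finsupp.degree_eq_zero_iff] at hl
    rw [this, h]

theorem mul_mem_ordIdeal {d e : ℕ} {f g : MvPowerSeries σ R} (hf : f ∈ ordIdeal σ R d)
    (hg : g ∈ ordIdeal σ R e) : f * g ∈ ordIdeal σ R (d + e) := by
  classical
  intro l hl
  rw [coeff_mul]
  refine Finset.sum_eq_zero fun p hp => ?_
  have := Finset.HasAntidiagonal.mem_antidiagonal.1 hp
  rw [← this, map_add] at hl
  by_cases h : p.1.degree < d
  · rw [hf _ h, zero_mul]
  · rw [hg _ (by omega), mul_zero]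

theorem monomial_mem_ordIdeal {d : ℕ} {k : σ →₀ ℕ} (h : d ≤ k.degree) (c : R) :
    monomial k c ∈ ordIdeal σ R d := by
  classical
  intro l hl
  rw [coeff_monomial, if_neg]
  rintro rfl
  omega

theorem eq_zero_of_forall_mem_ordIdeal {f : MvPowerSeries σ R} (h : ∀ d, f ∈ ordIdeal σ R d) :
    f = 0 := by
  ext l
  simpa using h (l.degree + 1) l (Nat.lt_succ_self _)

theorem pow_mem_ordIdeal {a : MvPowerSeries σ R} (ha : a ∈ ordIdeal σ R 1) (t : ℕ) :
    a ^ t ∈ ordIdeal σ R t := by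
  induction t with
  | zero => intro l hl; omega
  | succ t ih => rw [pow_succ]; exact mul_mem_ordIdeal ih ha

/-- Telescoping leaves one factor `a - b` of order `d` and `t - 1` factors of order `1`; the bound
is the order `d + t - 1`, stated without truncated subtraction. -/
theorem pow_sub_pow_mem_ordIdeal {a b : MvPowerSeries σ R} {d : ℕ} (ha : a ∈ ordIdeal σ R 1)
    (hb : b ∈ ordIdeal σ R 1) (hab : a - b ∈ ordIdeal σ R d) (t c : ℕ) (hc : c + 1 ≤ d + t) :
    a ^ t - b ^ t ∈ ordIdeal σ R c := by
  induction t generalizing c with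
  | zero => simp
  | succ t ih =>
    have : a ^ (t + 1) - b ^ (t + 1) = a ^ t * (a - b) + (a ^ t - b ^ t) * b := by ring
    rw [this]
    refine add_mem (ordIdeal_anti (by omega) (mul_mem_ordIdeal (pow_mem_ordIdeal ha t) hab)) ?_
    rcases Nat.eq_zero_or_pos (d + t) with h | h
    · intro l hl; omega
    · exact ordIdeal_anti (by omega) (mul_mem_ordIdeal (ih (d + t - 1) (by omega)) hb)

variable {a b : σ → MvPowerSeries τ R}

theorem finsuppProd_mem_ordIdeal (ha : ∀ s, a s ∈ ordIdeal τ R 1) (k : σ →₀ ℕ) :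
    (k.prod fun s e => a s ^ e) ∈ ordIdeal τ R k.degree := by
  classical
  induction k using Finsupp.induction_linear with
  | zero => intro l hl; simp at hl
  | add f g hf hg =>
    rw [Finsupp.prod_add_index' (by simp) (by intros; exact pow_add _ _ _), map_add]
    exact mul_mem_ordIdeal hf hg
  | single s t =>
    rw [Finsupp.prod_single_index (by simp), Finsupp.degree_single]
    exact pow_mem_ordIdeal (ha s) t

theorem finsuppProd_sub_mem_ordIdeal {d : ℕ} (ha : ∀ s, a s ∈ ordIdeal τ R 1)
    (hb : ∀ s, b s ∈ ordIdeal τ R 1) (hab : ∀ s, a s - b s ∈ ordIdeal τ R d) (k : σ →₀ ℕ) (c : ℕ)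
    (hc : c + 1 ≤ d + k.degree) :
    (k.prod fun s e => a s ^ e) - (k.prod fun s e => b s ^ e) ∈ ordIdeal τ R c := by
  classical
  induction k using Finsupp.induction_linear generalizing c with
  | zero => simp
  | add f g hf hg =>
    rw [map_add] at hc
    rw [Finsupp.prod_add_index' (by simp) (by intros; exact pow_add _ _ _),
      Finsupp.prod_add_index' (by simp) (by intros; exact pow_add _ _ _)]
    set A := f.prod fun s e => a s ^ e
    set A' := g.prod fun s e => a s ^ e
    set B := f.prod fun s e => b s ^ e
    set B' := g.prod fun s e => b s ^ e
    have : A * A' - B * B' = A * (A' - B') + (A - B) * B' := by ring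
    rw [this]
    refine add_mem ?_ ?_
    · rcases Nat.eq_zero_or_pos (d + g.degree) with h | h
      · exact ordIdeal_anti (by omega) (Ideal.mul_mem_right _ _ (finsuppProd_mem_ordIdeal ha f))
      · exact ordIdeal_anti (by omega)
          (mul_mem_ordIdeal (finsuppProd_mem_ordIdeal ha f) (hg (d + g.degree - 1) (by omega)))
    · rcases Nat.eq_zero_or_pos (d + f.degree) with h | h
      · exact ordIdeal_anti (by omega) (Ideal.mul_mem_left _ _ (finsuppProd_mem_ordIdeal hb g))
      · exact ordIdeal_anti (by omega)
          (mul_mem_ordIdeal (hf (d + f.degree - 1) (by omega)) (finsuppProd_mem_ordIdeal hb g))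
  | single s t =>
    rw [Finsupp.prod_single_index (by simp), Finsupp.prod_single_index (by simp)]
    rw [Finsupp.degree_single] at hc
    exact pow_sub_pow_mem_ordIdeal (ha s) (hb s) (hab s) t c hc

theorem hasSubst_of_mem_ordIdeal [Finite σ] (ha : ∀ s, a s ∈ ordIdeal τ R 1) : HasSubst a :=
  hasSubst_of_constantCoeff_zero fun s => mem_ordIdeal_one.1 (ha s)

theorem subst_mem_ordIdeal [Finite σ] {d : ℕ} {f : MvPowerSeries σ R}
    (ha : ∀ s, a s ∈ ordIdeal τ R 1) (hf : f ∈ ordIdeal σ R d) : f.subst a ∈ ordIdeal τ R d := by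
  intro l hl
  rw [coeff_subst (hasSubst_of_mem_ordIdeal ha)]
  refine finsum_eq_zero_of_forall_eq_zero fun k => ?_
  by_cases hk : k.degree < d
  · rw [hf k hk, zero_smul]
  · rw [finsuppProd_mem_ordIdeal ha k l (by omega), smul_zero]

/-- Two substitutions agreeing in degree `< d`, applied to a series of order `≥ e`, agree in
degree `< d + e - 1`. -/
theorem subst_sub_subst_mem_ordIdeal [Finite σ] {d e c : ℕ} {f : MvPowerSeries σ R}
    (ha : ∀ s, a s ∈ ordIdeal τ R 1) (hb : ∀ s, b s ∈ ordIdeal τ R 1)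
    (hab : ∀ s, a s - b s ∈ ordIdeal τ R d) (hf : f ∈ ordIdeal σ R e) (hc : c + 1 ≤ d + e) :
    f.subst a - f.subst b ∈ ordIdeal τ R c := by
  intro l hl
  rw [map_sub, coeff_subst (hasSubst_of_mem_ordIdeal ha),
    coeff_subst (hasSubst_of_mem_ordIdeal hb),
    ← finsum_sub_distrib (coeff_subst_finite (hasSubst_of_mem_ordIdeal ha) f l)
      (coeff_subst_finite (hasSubst_of_mem_ordIdeal hb) f l)]
  refine finsum_eq_zero_of_forall_eq_zero fun k => ?_
  by_cases hk : k.degree < e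
  · rw [hf k hk, zero_smul, zero_smul, sub_zero]
  · rw [← smul_sub, ← map_sub,
      finsuppProd_sub_mem_ordIdeal ha hb hab k c (by omega) l hl, smul_zero]

end OrdIdeal

/-! ### The conjugation equation in the variable `T = z^α` -/

section OneVariable

local notation "T" => (PowerSeries.X : PowerSeries ℂ)

/-- `p = 1 + O(T)` and `q = p + δ T ^ d + O(T ^ (d + 1))`. -/
def IsPerturbation (d : ℕ) (δ : ℂ) (q p : PowerSeries ℂ) : Prop :=
  T ∣ p - 1 ∧ T ^ (d + 1) ∣ q - p - PowerSeries.C δ * T ^ d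

/-- To first order this is the Leibniz rule at `p = p' = 1`; the quadratic term has order `2d ≥ d +
1` because `d ≥ 1`. -/
theorem IsPerturbation.mul {d : ℕ} (hd : 1 ≤ d) {δ δ' : ℂ} {q p q' p' : PowerSeries ℂ}
    (h : IsPerturbation d δ q p) (h' : IsPerturbation d δ' q' p') :
    IsPerturbation d (δ + δ') (q * q') (p * p') := by
  obtain ⟨e, rfl⟩ : ∃ e, d = e + 1 := ⟨d - 1, by omega⟩
  obtain ⟨⟨t, ht⟩, s, hs⟩ := h
  obtain ⟨⟨t', ht'⟩, s', hs'⟩ := h'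
  obtain rfl : p = 1 + T * t := by linear_combination ht
  obtain rfl : p' = 1 + T * t' := by linear_combination ht'
  obtain rfl : q = 1 + T * t + PowerSeries.C δ * T ^ (e + 1) + T ^ (e + 1 + 1) * s := by
    linear_combination hs
  obtain rfl : q' = 1 + T * t' + PowerSeries.C δ' * T ^ (e + 1) + T ^ (e + 1 + 1) * s' := by
    linear_combination hs'
  refine ⟨⟨t + t' + T * t * t', by ring⟩, ⟨t * PowerSeries.C δ' + (1 + T * t) * s'
    + t' * PowerSeries.C δ + s * (1 + T * t')
    + T ^ e * (PowerSeries.C δ + T * s) * (PowerSeries.C δ' + T * s'), ?_⟩⟩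
  rw [map_add]
  ring

theorem IsPerturbation.one (d : ℕ) : IsPerturbation d 0 1 1 := ⟨by simp, by simp⟩

theorem IsPerturbation.pow {d : ℕ} (hd : 1 ≤ d) {δ : ℂ} {q p : PowerSeries ℂ}
    (h : IsPerturbation d δ q p) (t : ℕ) : IsPerturbation d (t * δ) (q ^ t) (p ^ t) := by
  induction t with
  | zero => simpa using IsPerturbation.one d
  | succ t ih =>
    rw [pow_succ, pow_succ]
    convert ih.mul hd h using 1
    push_cast; ring

theorem IsPerturbation.prod {ι : Type*} {d : ℕ} (hd : 1 ≤ d) {δ : ι → ℂ}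
    {q p : ι → PowerSeries ℂ} (h : ∀ i, IsPerturbation d (δ i) (q i) (p i)) (s : Finset ι) :
    IsPerturbation d (∑ i ∈ s, δ i) (∏ i ∈ s, q i) (∏ i ∈ s, p i) := by
  classical
  induction s using Finset.induction_on with
  | empty => simpa using IsPerturbation.one d
  | insert a s ha ih =>
    rw [Finset.sum_insert ha, Finset.prod_insert ha, Finset.prod_insert ha]
    exact (h a).mul hd ih

theorem IsPerturbation.prod_pow {ι : Type*} [Fintype ι] {d : ℕ} (hd : 1 ≤ d) {δ : ι → ℂ}
    {q p : ι → PowerSeries ℂ} (h : ∀ i, IsPerturbation d (δ i) (q i) (p i)) (α : ι → ℕ) :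
    IsPerturbation d (∑ i, α i * δ i) (∏ i, q i ^ α i) (∏ i, p i ^ α i) :=
  IsPerturbation.prod hd (fun i => (h i).pow hd (α i)) _

theorem IsPerturbation.dvd_sub {d : ℕ} {δ : ℂ} {q p : PowerSeries ℂ}
    (h : IsPerturbation d δ q p) : T ^ d ∣ q - p := by
  obtain ⟨s, hs⟩ := h.2
  exact ⟨PowerSeries.C δ + T * s, by linear_combination hs⟩

theorem hasSubst_X_mul (G : PowerSeries ℂ) : PowerSeries.HasSubst (T * G) :=
  PowerSeries.HasSubst.of_constantCoeff_zero' (by simp)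

/-- Writing `s = T s₁ + s₀`, the difference is `T((G - 1) s₁(TG) + (s₁(TG) - s₁))`, so each
induction step gains a factor `T`. -/
theorem X_pow_dvd_subst_sub_self {r : ℕ} {G : PowerSeries ℂ} (hG : T ^ r ∣ G - 1)
    (s : PowerSeries ℂ) : T ^ r ∣ s.subst (T * G) - s := by
  have hg := hasSubst_X_mul G
  suffices H : ∀ t ≤ r, ∀ s : PowerSeries ℂ, T ^ t ∣ s.subst (T * G) - s from H r le_rfl s
  intro t
  induction t with
  | zero => simp
  | succ t ih =>
    intro ht s
    obtain ⟨s₁, s₀, hs⟩ : ∃ (s₁ : PowerSeries ℂ) (s₀ : ℂ), s = T * s₁ + PowerSeries.C s₀ :=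
      ⟨_, _, PowerSeries.eq_X_mul_shift_add_const s⟩
    obtain ⟨w, hw⟩ := ih (by omega) s₁
    obtain ⟨v, hv⟩ := (pow_dvd_pow T (show t ≤ r by omega)).trans hG
    have hC : (PowerSeries.C s₀).subst (T * G) = PowerSeries.C s₀ := PowerSeries.subst_C s₀
    rw [hs, PowerSeries.subst_add hg, PowerSeries.subst_mul hg, PowerSeries.subst_X hg, hC]
    refine ⟨v * s₁.subst (T * G) + w, ?_⟩
    linear_combination T * s₁.subst (T * G) * hv + T * hw

/-- To leading order, composing with `T(1 + ΛT^r)` adds `ΛT^(r+1) D'`, which here is `dΛδ T^(d+r)`.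
-/
theorem subst_sub_self_of_X_pow_dvd {d r : ℕ} (hr : 1 ≤ r) {δ Λ : ℂ} {G D : PowerSeries ℂ}
    (hG : IsPerturbation r Λ G 1) (hD : T ^ (d + 1) ∣ D - PowerSeries.C δ * T ^ d) :
    T ^ (d + r + 1) ∣ D.subst (T * G) - D - PowerSeries.C (d * Λ * δ) * T ^ (d + r) := by
  have hg := hasSubst_X_mul G
  obtain ⟨s, hs⟩ := hD
  obtain rfl : D = PowerSeries.C δ * T ^ d + T ^ (d + 1) * s := by linear_combination hs
  obtain ⟨w, hw⟩ := (hG.pow hr d).2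
  obtain ⟨v, hv⟩ := (hG.pow hr (d + 1)).dvd_sub
  obtain ⟨x, hx⟩ := X_pow_dvd_subst_sub_self hG.dvd_sub s
  have hC : (PowerSeries.C δ).subst (T * G) = PowerSeries.C δ := PowerSeries.subst_C δ
  rw [PowerSeries.subst_add hg, PowerSeries.subst_mul hg, PowerSeries.subst_mul hg,
    PowerSeries.subst_pow hg, PowerSeries.subst_pow hg, PowerSeries.subst_X hg, hC]
  refine ⟨PowerSeries.C δ * w + v * s.subst (T * G) + x, ?_⟩
  simp only [one_pow, map_mul] at hw hv ⊢
  rw [mul_pow, mul_pow]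
  linear_combination PowerSeries.C δ * T ^ d * hw + T ^ (d + 1) * s.subst (T * G) * hv
    + T ^ (d + 1) * hx

variable {ι : Type*} [Fintype ι]

/-- The defect of `z_j ↦ z_j p_j(z ^ α)` as a conjugation from `z_j ↦ z_j h_j(z ^ α)` to
`z_j ↦ z_j (λ_j + c_j z ^ (r α) + μ β_j z ^ (2 r α))`, written in the variable `z ^ α`. -/
noncomputable def conjDefect (r : ℕ) (α : ι → ℕ) (lam c β : ι → ℂ) (h : ι → PowerSeries ℂ)
    (p : ι → PowerSeries ℂ) (μ : ℂ) (j : ι) : PowerSeries ℂ :=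
  h j * (p j).subst (T * ∏ i, h i ^ α i)
    - p j * (PowerSeries.C (lam j) + PowerSeries.C (c j) * (T * ∏ i, p i ^ α i) ^ r
      + PowerSeries.C (μ * β j) * (T * ∏ i, p i ^ α i) ^ (2 * r))

variable {r : ℕ} {α : ι → ℕ} {lam c β : ι → ℂ} {h : ι → PowerSeries ℂ}

/-- Normalise to `h_i / λ_i = 1 + (c_i / λ_i) T^r + ⋯`; this does not change the product, since `∏
λ_i^α_i = 1`. -/
theorem isPerturbation_prod_pow (hr : 1 ≤ r) (hlam : ∀ j, lam j ≠ 0)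
    (hprod : ∏ i, lam i ^ α i = 1)
    (hh : ∀ j, T ^ (r + 1) ∣ h j - PowerSeries.C (lam j) - PowerSeries.C (c j) * T ^ r) :
    IsPerturbation r (∑ i, c i * α i / lam i) (∏ i, h i ^ α i) 1 := by
  have hi : ∀ i, IsPerturbation r (c i / lam i) (PowerSeries.C (lam i)⁻¹ * h i) 1 := by
    intro i
    obtain ⟨s, hs⟩ := hh i
    refine ⟨by simp, PowerSeries.C (lam i)⁻¹ * s, ?_⟩
    have h1 : PowerSeries.C (lam i)⁻¹ * PowerSeries.C (lam i) = 1 := by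
      rw [← map_mul, inv_mul_cancel₀ (hlam i), map_one]
    rw [div_eq_inv_mul, map_mul]
    linear_combination PowerSeries.C (lam i)⁻¹ * hs + h1
  have := IsPerturbation.prod_pow hr hi α
  have e : ∏ i, (PowerSeries.C (lam i)⁻¹ * h i) ^ α i = ∏ i, h i ^ α i := by
    simp_rw [mul_pow, Finset.prod_mul_distrib, ← map_pow, ← map_prod, inv_pow,
      Finset.prod_inv_distrib, hprod]
    simp
  rw [e] at this
  simp only [one_pow, Finset.prod_const_one] at this
  convert this using 1
  refine Finset.sum_congr rfl fun i _ => by ring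

/-- The contributions `λ_j δ_j T^d` and `c_j δ_j T^(d+r)` occur on both sides of the conjugation
equation and cancel. What remains is the effect of `T ↦ TG` on `δ_j T^d` and the variation of `P^r`.
Changing `μ` acts from degree `2r` on, so it is allowed only while `d ≤ r`. -/
theorem conjDefect_sub_conjDefect {d : ℕ} (hd : 1 ≤ d) (hr : 1 ≤ r) (hlam : ∀ j, lam j ≠ 0)
    (hprod : ∏ i, lam i ^ α i = 1)
    (hh : ∀ j, T ^ (r + 1) ∣ h j - PowerSeries.C (lam j) - PowerSeries.C (c j) * T ^ r)
    {δ : ι → ℂ} {q p : ι → PowerSeries ℂ} (hqp : ∀ i, IsPerturbation d (δ i) (q i) (p i))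
    {μ μ' : ℂ} (hμ : r < d → μ' = μ) (j : ι) :
    T ^ (d + r + 1) ∣ conjDefect r α lam c β h q μ' j - conjDefect r α lam c β h p μ j
      - PowerSeries.C (lam j * (d * (∑ i, c i * α i / lam i) * δ j) - c j * (r * ∑ i, α i * δ i)
          - if d = r then (μ' - μ) * β j else 0) * T ^ (d + r) := by
  have hG := isPerturbation_prod_pow hr hlam hprod hh
  set Λ := ∑ i, c i * α i / lam i
  set G := ∏ i, h i ^ α i with hGdef
  have hD : T ^ (d + 1) ∣ (q j - p j) - PowerSeries.C (δ j) * T ^ d := (hqp j).2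
  have h1 := subst_sub_self_of_X_pow_dvd hr hG hD
  have hPQ := IsPerturbation.prod_pow hd hqp α
  set S := ∑ i, (α i : ℂ) * δ i
  have hr1 := (hPQ.pow hd r).mul hd (hqp j)
  have hr2 := (hPQ.pow hd (2 * r)).mul hd (hqp j)
  unfold conjDefect
  rw [← hGdef]
  set Q := ∏ i, q i ^ α i
  set P := ∏ i, p i ^ α i
  -- the contribution of the coefficient `μ`
  have h3 : T ^ (d + r + 1) ∣ (PowerSeries.C (μ' * β j) * T ^ (2 * r) * (Q ^ (2 * r) * q j)
      - PowerSeries.C (μ * β j) * T ^ (2 * r) * (P ^ (2 * r) * p j))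
      - PowerSeries.C (if d = r then (μ' - μ) * β j else 0) * T ^ (d + r) := by
    -- If `d < r`, everything starts in degree `2r > d + r`. If `d > r`, `μ` is fixed and the
    -- variation has order `2r + d`. Only `d = r` contributes.
    rcases lt_trichotomy d r with hlt | heq | hgt
    · rw [if_neg hlt.ne, map_zero, zero_mul, sub_zero]
      refine Dvd.dvd.trans (pow_dvd_pow T (show d + r + 1 ≤ 2 * r by omega)) ?_
      exact ⟨PowerSeries.C (μ' * β j) * (Q ^ (2 * r) * q j)
        - PowerSeries.C (μ * β j) * (P ^ (2 * r) * p j), by ring⟩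
    · rw [if_pos heq]
      obtain ⟨t, ht⟩ := hr2.1
      obtain ⟨s, hs⟩ := hr2.dvd_sub
      obtain ⟨e, he⟩ : ∃ e, d = e + 1 := ⟨d - 1, by omega⟩
      have h2r : 2 * r = d + r := by omega
      refine ⟨PowerSeries.C (μ' * β j) * T ^ e * s + PowerSeries.C ((μ' - μ) * β j) * t, ?_⟩
      rw [h2r] at hs ht ⊢
      have hTd : T ^ d = T ^ e * T := by rw [he, pow_succ]
      rw [hTd] at hs
      have hmu : PowerSeries.C ((μ' - μ) * β j)
          = PowerSeries.C (μ' * β j) - PowerSeries.C (μ * β j) := by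
        rw [← map_sub]; congr 1; ring
      rw [hmu]
      linear_combination PowerSeries.C (μ' * β j) * T ^ (d + r) * hs
        + (PowerSeries.C (μ' * β j) - PowerSeries.C (μ * β j)) * T ^ (d + r) * ht
    · rw [if_neg hgt.ne', map_zero, zero_mul, sub_zero, hμ hgt]
      obtain ⟨s, hs⟩ := hr2.dvd_sub
      refine ⟨PowerSeries.C (μ * β j) * T ^ (r - 1) * s, ?_⟩
      have hT : T ^ (d + r + 1) * T ^ (r - 1) = T ^ (2 * r) * T ^ d := by
        rw [← pow_add, ← pow_add]; congr 1; omega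
      linear_combination PowerSeries.C (μ * β j) * T ^ (2 * r) * hs
        - PowerSeries.C (μ * β j) * s * hT
  obtain ⟨y, hy⟩ := h3
  obtain ⟨x, hx⟩ := h1
  obtain ⟨s, hs⟩ := hr1.2
  obtain ⟨k, hk⟩ := hh j
  obtain ⟨w, hw⟩ := hD
  rw [PowerSeries.subst_sub (hasSubst_X_mul G)] at hx
  set U := (q j).subst (T * G)
  set V := (p j).subst (T * G)
  obtain ⟨e, he⟩ : ∃ e, r = e + 1 := ⟨r - 1, by omega⟩
  have hTr : T ^ r = T ^ e * T := by rw [he, pow_succ]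
  refine ⟨h j * x + k * PowerSeries.C (δ j) + PowerSeries.C (c j) * w + T * k * w
    + (PowerSeries.C (c j) + T * k) * PowerSeries.C (d * Λ * δ j) * T ^ e
    - PowerSeries.C (c j) * s - y, ?_⟩
  simp only [map_sub, map_mul, map_add] at hy hx hs hk hw ⊢
  simp only [mul_pow]
  linear_combination h j * hx
    + (q j - p j + PowerSeries.C (d : ℂ) * PowerSeries.C Λ * PowerSeries.C (δ j) * T ^ (d + r)) * hk
    + (PowerSeries.C (c j) * T ^ r + T ^ (r + 1) * k) * hw - PowerSeries.C (c j) * T ^ r * hs - hy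
    + (PowerSeries.C (c j) + T * k) * PowerSeries.C (d : ℂ) * PowerSeries.C Λ
      * PowerSeries.C (δ j) * T ^ (d + r) * hTr

theorem X_pow_dvd_conjDefect_sub_conjDefect {d : ℕ} (hd : 1 ≤ d) (hr : 1 ≤ r)
    (hlam : ∀ j, lam j ≠ 0) (hprod : ∏ i, lam i ^ α i = 1)
    (hh : ∀ j, T ^ (r + 1) ∣ h j - PowerSeries.C (lam j) - PowerSeries.C (c j) * T ^ r)
    {δ : ι → ℂ} {q p : ι → PowerSeries ℂ} (hqp : ∀ i, IsPerturbation d (δ i) (q i) (p i))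
    {μ μ' : ℂ} (hμ : r < d → μ' = μ) (j : ι) :
    T ^ (d + r) ∣ conjDefect r α lam c β h q μ' j - conjDefect r α lam c β h p μ j :=
  (dvd_sub_left (Dvd.intro_left _ rfl)).1 ((pow_dvd_pow T (Nat.le_succ (d + r))).trans
    (conjDefect_sub_conjDefect (β := β) hd hr hlam hprod hh hqp hμ j))

/-- Solving the linear system that appears in degree `d` of the conjugation equation. -/
theorem exists_linear_solution {d : ℕ} (hd : 1 ≤ d) (hlam : ∀ j, lam j ≠ 0)
    (hΛ : ∑ i, c i * α i / lam i ≠ 0) (hβ : ∑ i, β i * α i / lam i ≠ 0) (v : ι → ℂ) :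
    ∃ (δ : ι → ℂ) (ν : ℂ), (d ≠ r → ν = 0) ∧ ∀ j,
      v j + (lam j * (d * (∑ i, c i * α i / lam i) * δ j) - c j * (r * ∑ i, α i * δ i)
          - if d = r then ν * β j else 0) = 0 := by
  set Λ := ∑ i, c i * α i / lam i with hΛdef
  have hd0 : (d : ℂ) ≠ 0 := by exact_mod_cast (by omega : d ≠ 0)
  by_cases hdr : d = r
  -- At `d = r` the unknown `S` drops out of the pairing with `α_j / λ_j`; `ν` gives `v - νβ` zero
  -- pairing, which is consistent with the choice `S = 0`.
  · let ν : ℂ := (∑ i, v i * α i / lam i) / ∑ i, β i * α i / lam i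
    let δ : ι → ℂ := fun j => (ν * β j - v j) / (lam j * (d * Λ))
    have hS : ∑ i, α i * δ i = 0 := by
      have : ∑ i, α i * δ i
          = (ν * (∑ i, β i * α i / lam i) - ∑ i, v i * α i / lam i) / (d * Λ) := by
        rw [Finset.mul_sum, ← Finset.sum_sub_distrib, Finset.sum_div]
        refine Finset.sum_congr rfl fun i _ => ?_
        have := hlam i
        simp only [δ]
        field_simp
      rw [this, div_mul_cancel₀ _ hβ, sub_self, zero_div]
    refine ⟨δ, ν, fun h => absurd hdr h, fun j => ?_⟩
    rw [hS, if_pos hdr]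
    have := hlam j
    simp only [δ]
    field_simp
    ring
  · have hdr' : (d : ℂ) - r ≠ 0 := sub_ne_zero.2 (by exact_mod_cast hdr)
    -- Pairing the system with `α_j / λ_j` yields `(d - r)ΛS = -∑ v_i α_i / λ_i`; once `S` is known
    -- the equations decouple.
    let S : ℂ := -(∑ i, v i * α i / lam i) / ((d - r) * Λ)
    let δ : ι → ℂ := fun j => (c j * (r * S) - v j) / (lam j * (d * Λ))
    have hS : ∑ i, α i * δ i = S := by
      have : ∑ i, α i * δ i = (r * S * Λ - ∑ i, v i * α i / lam i) / (d * Λ) := by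
        rw [hΛdef, Finset.mul_sum, ← Finset.sum_sub_distrib, Finset.sum_div, ← hΛdef]
        refine Finset.sum_congr rfl fun i _ => ?_
        have := hlam i
        simp only [δ]
        field_simp
      rw [this]
      simp only [S]
      field_simp
      ring
    refine ⟨δ, 0, fun _ => rfl, fun j => ?_⟩
    rw [hS, if_neg hdr]
    have := hlam j
    simp only [δ]
    field_simp
    ring

/-- For `p = 1`, `μ = 0` the defect is `h_j - λ_j - c_j T^r`. Any other admissible `p` is a
perturbation with `d = 1`, which is felt only from degree `r + 1` on. -/
theorem X_pow_dvd_conjDefect (hr : 1 ≤ r) (hlam : ∀ j, lam j ≠ 0)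
    (hprod : ∏ i, lam i ^ α i = 1)
    (hh : ∀ j, T ^ (r + 1) ∣ h j - PowerSeries.C (lam j) - PowerSeries.C (c j) * T ^ r)
    {p : ι → PowerSeries ℂ} (hp : ∀ i, T ∣ p i - 1) (μ : ℂ) (j : ι) :
    T ^ (r + 1) ∣ conjDefect r α lam c β h p μ j := by
  have hone : T ^ (r + 1) ∣ conjDefect r α lam c β h (fun _ => 1) 0 j := by
    have h1 : (1 : PowerSeries ℂ).subst (T * ∏ i, h i ^ α i) = 1 := by
      rw [← PowerSeries.coe_substAlgHom (hasSubst_X_mul _), map_one]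
    simpa [conjDefect, h1, sub_sub] using hh j
  have hq : ∀ i, IsPerturbation 1 (PowerSeries.coeff 1 (p i)) (p i) 1 := by
    intro i
    refine ⟨by simp, PowerSeries.X_pow_dvd_iff.2 fun t ht => ?_⟩
    obtain ⟨s, hs⟩ := hp i
    interval_cases t
    · simp [hs]
    · simp [PowerSeries.coeff_one]
  have := X_pow_dvd_conjDefect_sub_conjDefect (β := β) le_rfl hr hlam hprod hh hq
    (μ := 0) (μ' := μ) (fun h => by omega) j
  rw [add_comm 1 r] at this
  simpa using dvd_add this hone

theorem exists_conjDefect_eq_zero (hr : 1 ≤ r) (hlam : ∀ j, lam j ≠ 0)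
    (hprod : ∏ i, lam i ^ α i = 1)
    (hh : ∀ j, T ^ (r + 1) ∣ h j - PowerSeries.C (lam j) - PowerSeries.C (c j) * T ^ r)
    (hΛ : ∑ i, c i * α i / lam i ≠ 0) (hβ : ∑ i, β i * α i / lam i ≠ 0) :
    ∃ (p : ι → PowerSeries ℂ) (μ : ℂ), (∀ j, PowerSeries.constantCoeff (p j) = 1) ∧
      ∀ j, conjDefect r α lam c β h p μ j = 0 := by
  -- Level `s` of the unknown `x` holds the `T^s` coefficients of all `p_j` and a candidate for `μ`;
  -- only the candidate at level `r` is read, so `μ` is settled at step `d = r`.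
  let p : (ℕ → (ι → ℂ) × ℂ) → ι → PowerSeries ℂ := fun x j =>
    PowerSeries.mk fun s => if s = 0 then 1 else (x s).1 j
  have hp : ∀ x i, T ∣ p x i - 1 := by
    intro x i
    rw [PowerSeries.X_dvd_iff]
    rw [map_sub, ← PowerSeries.coeff_zero_eq_constantCoeff_apply, PowerSeries.coeff_mk]
    simp
  have hpert : ∀ d x y, 1 ≤ d → (∀ s < d, x s = y s) → ∀ i,
      IsPerturbation d ((y d).1 i - (x d).1 i) (p y i) (p x i) := by
    intro d x y hd hxy i
    refine ⟨hp x i, PowerSeries.X_pow_dvd_iff.2 fun t ht => ?_⟩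
    rcases Nat.lt_or_ge t d with h | h
    · rw [map_sub, map_sub, PowerSeries.coeff_C_mul, PowerSeries.coeff_X_pow, if_neg h.ne]
      simp [p, hxy t h]
    · obtain rfl : t = d := by omega
      rw [map_sub, map_sub, PowerSeries.coeff_C_mul, PowerSeries.coeff_X_pow, if_pos rfl]
      have ht0 : t ≠ 0 := by omega
      simp only [p, PowerSeries.coeff_mk, if_neg ht0]
      ring
  suffices H : ∃ x : ℕ → (ι → ℂ) × ℂ, ∀ d, ∀ j,
      T ^ (d + r) ∣ conjDefect r α lam c β h (p x) (x r).2 j by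
    obtain ⟨x, hx⟩ := H
    refine ⟨p x, (x r).2, fun j => ?_, fun j => ?_⟩
    · rw [← PowerSeries.coeff_zero_eq_constantCoeff_apply, PowerSeries.coeff_mk, if_pos rfl]
    · ext t
      simpa using PowerSeries.X_pow_dvd_iff.1 (hx (t + 1) j) t (by omega)
  refine exists_forall_of_approx id _ ?_ ?_ (fun _ => (0, 0)) ?_
  · intro d x y hx hxy j
    rcases Nat.eq_zero_or_pos d with rfl | hd
    · exact (pow_dvd_pow T (by omega)).trans
        (X_pow_dvd_conjDefect hr hlam hprod hh (hp y) (y r).2 j)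
    · have := X_pow_dvd_conjDefect_sub_conjDefect (β := β) hd hr hlam hprod hh
        (hpert d x y hd hxy) (μ := (x r).2) (μ' := (y r).2) (fun h => by rw [hxy r h]) j
      simpa using dvd_add this (hx j)
  · intro d x hx
    rcases Nat.eq_zero_or_pos d with rfl | hd
    · refine ⟨x, fun _ _ => rfl, fun j => ?_⟩
      exact (pow_dvd_pow T (by omega)).trans
        (X_pow_dvd_conjDefect hr hlam hprod hh (hp x) (x r).2 j)
    -- The constant term of `w j` is the `T^(d+r)` coefficient of the defect, which the change at
    -- level `d` must cancel.
    · choose w hw using hx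
      obtain ⟨δ, ν, hν, hδ⟩ := exists_linear_solution (r := r) hd hlam hΛ hβ
        (fun j => PowerSeries.constantCoeff (w j))
      let y : ℕ → (ι → ℂ) × ℂ := Function.update x d ((x d).1 + δ, (x d).2 + ν)
      have hxy : ∀ s < d, x s = y s := fun s hs => by simp [y, hs.ne]
      refine ⟨y, hxy, fun j => ?_⟩
      obtain ⟨s, hs⟩ := conjDefect_sub_conjDefect (β := β) hd hr hlam hprod hh
        (hpert d x y hd hxy) (μ := (x r).2) (μ' := (y r).2) (fun h => by rw [hxy r h]) j
      have hν' : (if d = r then ((y r).2 - (x r).2) * β j else 0)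
          = if d = r then ν * β j else 0 := by
        split_ifs with hdr
        · subst hdr; simp [y]
        · rfl
      have hδ' : ∀ i, (y d).1 i - (x d).1 i = δ i := fun i => by simp [y]
      simp only [hν', hδ'] at hs
      have hj := hδ j
      rw [← eq_neg_iff_add_eq_zero, eq_comm, neg_eq_iff_eq_neg] at hj
      rw [hj, map_neg] at hs
      obtain ⟨t, ht⟩ : T ∣ w j - PowerSeries.C (PowerSeries.constantCoeff (w j)) := by
        rw [PowerSeries.X_dvd_iff]; simp
      refine ⟨s + t, ?_⟩
      linear_combination (exp := 1) hs + hw j + T ^ (d + r) * ht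
  · intro j
    exact (pow_dvd_pow T (by omega)).trans
      (X_pow_dvd_conjDefect hr hlam hprod hh (hp _) _ j)

end OneVariable

/-! ### Homological equation and Poincaré–Dulac normal form -/

section PoincareDulac

variable {n : ℕ}

/-- The linear formal map `diag(lam)`. -/
noncomputable def diagMap (lam : Fin n → ℂ) : FormalMap n := fun j => C (lam j) * X j

theorem X_mem_ordIdeal (j : Fin n) : (X j : MvPowerSeries (Fin n) ℂ) ∈ ordIdeal (Fin n) ℂ 1 :=
  mem_ordIdeal_one.2 (by simp)

theorem diagMap_mem_ordIdeal (lam : Fin n → ℂ) (j : Fin n) :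
    diagMap lam j ∈ ordIdeal (Fin n) ℂ 1 := Ideal.mul_mem_left _ _ (X_mem_ordIdeal j)

theorem coeff_subst_diagMap (lam : Fin n → ℂ) (f : MvPowerSeries (Fin n) ℂ) (l : Fin n →₀ ℕ) :
    coeff l (f.subst (diagMap lam)) = (∏ i, lam i ^ l i) * coeff l f := by
  have : diagMap lam = lam • (X : Fin n → MvPowerSeries (Fin n) ℂ) := by
    funext j
    simp [diagMap, smul_eq_C_mul]
  rw [this, ← rescale_eq_subst, coeff_rescale, Finsupp.prod_fintype _ _ (by simp)]

theorem exists_eq_single_of_degree_eq_one {l : Fin n →₀ ℕ} (h : l.degree = 1) :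
    ∃ i, l = Finsupp.single i 1 := by
  have : l ∈ {d : Fin n →₀ ℕ | d.degree = 1} := h
  rw [← Finsupp.range_single_one] at this
  obtain ⟨i, hi⟩ := this
  exact ⟨i, hi.symm⟩

theorem sub_mem_ordIdeal_two {f g : MvPowerSeries (Fin n) ℂ}
    (h0 : constantCoeff f = constantCoeff g)
    (h1 : ∀ i, coeff (Finsupp.single i 1) f = coeff (Finsupp.single i 1) g) :
    f - g ∈ ordIdeal (Fin n) ℂ 2 := by
  intro l hl
  rcases Nat.lt_or_ge l.degree 1 with h | h
  · exact mem_ordIdeal_one.2 (show constantCoeff (f - g) = 0 by rw [map_sub, h0, sub_self]) l h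
  · obtain ⟨i, rfl⟩ := exists_eq_single_of_degree_eq_one (by omega : l.degree = 1)
    rw [map_sub, h1, sub_self]

theorem mem_ordIdeal_one_of_sub {f g : MvPowerSeries (Fin n) ℂ}
    (h : f - g ∈ ordIdeal (Fin n) ℂ 2) (hg : g ∈ ordIdeal (Fin n) ℂ 1) :
    f ∈ ordIdeal (Fin n) ℂ 1 := by
  simpa using add_mem (ordIdeal_anti one_le_two h) hg

theorem sub_diagMap_mem_ordIdeal {lam : Fin n → ℂ} {G : FormalMap n}
    (h0 : ∀ j, constantCoeff (G j) = 0) (h1 : G.linearPart = Matrix.diagonal lam) (j : Fin n) :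
    G j - diagMap lam j ∈ ordIdeal (Fin n) ℂ 2 := by
  classical
  refine sub_mem_ordIdeal_two (by simp [h0, diagMap]) fun i => ?_
  have := congrFun (congrFun h1 j) i
  rw [FormalMap.linearPart, Matrix.of_apply] at this
  rw [this, diagMap, coeff_C_mul, coeff_X, Matrix.diagonal_apply]
  by_cases h : j = i
  · simp [h]
  · have h' : Finsupp.single i 1 ≠ (Finsupp.single j 1 : Fin n →₀ ℕ) := by
      intro h'
      exact h (Finsupp.single_left_injective one_ne_zero h').symm
    simp [h, h']

variable {lam : Fin n → ℂ} {G : FormalMap n}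

/-- Variation of the defect `Ψ_j ∘ G - η ∘ Ψ` of the conjugation equation: up to higher order it is
given by the homological operator. -/
theorem defect_sub_defect {d : ℕ} (hG : ∀ j, G j - diagMap lam j ∈ ordIdeal (Fin n) ℂ 2)
    {Ψ Ψ' : FormalMap n} (hΨ : ∀ j, Ψ j - X j ∈ ordIdeal (Fin n) ℂ 2)
    (hΨ' : ∀ j, Ψ' j - X j ∈ ordIdeal (Fin n) ℂ 2) {η η' : MvPowerSeries (Fin n) ℂ} (j : Fin n)
    (hD : Ψ' j - Ψ j ∈ ordIdeal (Fin n) ℂ d) (hR : η' - η ∈ ordIdeal (Fin n) ℂ d)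
    (hK : (η - diagMap lam j).subst Ψ' - (η - diagMap lam j).subst Ψ
      ∈ ordIdeal (Fin n) ℂ (d + 1)) :
    ((Ψ' j).subst G - η'.subst Ψ') - ((Ψ j).subst G - η.subst Ψ)
      - ((Ψ' j - Ψ j).subst (diagMap lam) - C (lam j) * (Ψ' j - Ψ j) - (η' - η))
      ∈ ordIdeal (Fin n) ℂ (d + 1) := by
  have hG1 := fun i => mem_ordIdeal_one_of_sub (hG i) (diagMap_mem_ordIdeal lam i)
  have hΨ1 := fun i => mem_ordIdeal_one_of_sub (hΨ i) (X_mem_ordIdeal i)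
  have hΨ1' := fun i => mem_ordIdeal_one_of_sub (hΨ' i) (X_mem_ordIdeal i)
  have sΨ := hasSubst_of_mem_ordIdeal hΨ1
  have sΨ' := hasSubst_of_mem_ordIdeal hΨ1'
  have sG := hasSubst_of_mem_ordIdeal hG1
  have e1 : (Ψ' j - Ψ j).subst G - (Ψ' j - Ψ j).subst (diagMap lam)
      ∈ ordIdeal (Fin n) ℂ (d + 1) :=
    subst_sub_subst_mem_ordIdeal hG1 (diagMap_mem_ordIdeal lam) hG hD (by omega)
  have e2 : (η' - η).subst Ψ' - (η' - η).subst (X : FormalMap n)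
      ∈ ordIdeal (Fin n) ℂ (d + 1) :=
    subst_sub_subst_mem_ordIdeal hΨ1' X_mem_ordIdeal hΨ' hR (by omega)
  rw [subst_self, id] at e2
  rw [subst_sub sG] at e1
  rw [subst_sub sΨ'] at e2
  have hdiag : ∀ {Φ : FormalMap n}, HasSubst Φ → (diagMap lam j).subst Φ = C (lam j) * Φ j := by
    intro Φ s
    rw [diagMap, subst_mul s, subst_C, subst_X s]
  rw [subst_sub sΨ', subst_sub sΨ, hdiag sΨ, hdiag sΨ'] at hK
  convert sub_mem (sub_mem e1 e2) hK using 1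
  ring

theorem defect_mem_ordIdeal_two (hG : ∀ j, G j - diagMap lam j ∈ ordIdeal (Fin n) ℂ 2)
    {Ψ : FormalMap n} (hΨ : ∀ j, Ψ j - X j ∈ ordIdeal (Fin n) ℂ 2)
    {η : MvPowerSeries (Fin n) ℂ} (j : Fin n) (hη : η - diagMap lam j ∈ ordIdeal (Fin n) ℂ 2) :
    (Ψ j).subst G - η.subst Ψ ∈ ordIdeal (Fin n) ℂ 2 := by
  have hG1 := fun i => mem_ordIdeal_one_of_sub (hG i) (diagMap_mem_ordIdeal lam i)
  have hΨ1 := fun i => mem_ordIdeal_one_of_sub (hΨ i) (X_mem_ordIdeal i)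
  have sΨ := hasSubst_of_mem_ordIdeal hΨ1
  have sG := hasSubst_of_mem_ordIdeal hG1
  have e1 := subst_mem_ordIdeal hG1 (hΨ j)
  have e2 := subst_mem_ordIdeal hΨ1 hη
  rw [subst_sub sG, subst_X sG] at e1
  rw [subst_sub sΨ, diagMap, subst_mul sΨ, subst_C, subst_X sΨ] at e2
  have e3 := Ideal.mul_mem_left _ (C (lam j)) (hΨ j)
  have e4 := hG j
  rw [diagMap] at e4
  convert sub_mem (sub_mem (add_mem e1 e4) e2) e3 using 1
  ring

/-- The **Poincaré–Dulac theorem**: a formal map with diagonal linear part is conjugate, by a map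
tangent to the identity, to one with only resonant monomials. -/
theorem exists_poincareDulac (hG : ∀ j, G j - diagMap lam j ∈ ordIdeal (Fin n) ℂ 2) :
    ∃ Ψ H : FormalMap n, (∀ j, Ψ j - X j ∈ ordIdeal (Fin n) ℂ 2) ∧
      (∀ j, H j - diagMap lam j ∈ ordIdeal (Fin n) ℂ 2) ∧
      (∀ j, (Ψ j).subst G = (H j).subst Ψ) ∧
      (∀ j l, lam j = ∏ i, lam i ^ l i → coeff l (Ψ j - X j) = 0) ∧
      (∀ j l, lam j ≠ ∏ i, lam i ^ l i → coeff l (H j - diagMap lam j) = 0) := by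
  classical
  -- One array `x` encodes both maps: the entry `x l j` is a coefficient of `Ψ_j` if `(j, l)` is
  -- nonresonant and of `H_j` if it is resonant.
  let N : ((Fin n →₀ ℕ) → Fin n → ℂ) → FormalMap n := fun x j l =>
    if 2 ≤ l.degree ∧ lam j ≠ ∏ i, lam i ^ l i then x l j else 0
  let R : ((Fin n →₀ ℕ) → Fin n → ℂ) → FormalMap n := fun x j l =>
    if 2 ≤ l.degree ∧ lam j = ∏ i, lam i ^ l i then x l j else 0
  have cN : ∀ x j l, coeff l (N x j)
      = if 2 ≤ l.degree ∧ lam j ≠ ∏ i, lam i ^ l i then x l j else 0 := fun _ _ _ => rfl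
  have cR : ∀ x j l, coeff l (R x j)
      = if 2 ≤ l.degree ∧ lam j = ∏ i, lam i ^ l i then x l j else 0 := fun _ _ _ => rfl
  have hN : ∀ x j, N x j ∈ ordIdeal (Fin n) ℂ 2 := by
    intro x j l hl
    rw [cN, if_neg (by omega)]
  have hR : ∀ x j, R x j ∈ ordIdeal (Fin n) ℂ 2 := by
    intro x j l hl
    rw [cR, if_neg (by omega)]
  let Ψ : ((Fin n →₀ ℕ) → Fin n → ℂ) → FormalMap n := fun x j => X j + N x j
  let H : ((Fin n →₀ ℕ) → Fin n → ℂ) → FormalMap n := fun x j => diagMap lam j + R x j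
  have hΨN : ∀ x j, Ψ x j - X j = N x j := fun x j => add_sub_cancel_left _ _
  have hHR : ∀ x j, H x j - diagMap lam j = R x j := fun x j => add_sub_cancel_left _ _
  have hΨ : ∀ x j, Ψ x j - X j ∈ ordIdeal (Fin n) ℂ 2 := fun x j => by rw [hΨN]; exact hN x j
  have hH : ∀ x j, H x j - diagMap lam j ∈ ordIdeal (Fin n) ℂ 2 :=
    fun x j => by rw [hHR]; exact hR x j
  have hΨ1 := fun x i => mem_ordIdeal_one_of_sub (hΨ x i) (X_mem_ordIdeal i)
  have hE2 : ∀ x j, (Ψ x j).subst G - (H x j).subst (Ψ x) ∈ ordIdeal (Fin n) ℂ 2 :=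
    fun x j => defect_mem_ordIdeal_two hG (hΨ x) j (hH x j)
  have hND : ∀ d x y, (∀ l : Fin n →₀ ℕ, l.degree < d → x l = y l) → ∀ j,
      Ψ y j - Ψ x j ∈ ordIdeal (Fin n) ℂ d := by
    intro d x y hxy j l hl
    have : Ψ y j - Ψ x j = N y j - N x j := by rw [← hΨN, ← hΨN]; ring
    rw [this, map_sub, cN, cN, hxy l hl, sub_self]
  have hRD : ∀ d x y, (∀ l : Fin n →₀ ℕ, l.degree < d → x l = y l) → ∀ j,
      H y j - H x j ∈ ordIdeal (Fin n) ℂ d := by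
    intro d x y hxy j l hl
    have : H y j - H x j = R y j - R x j := by rw [← hHR, ← hHR]; ring
    rw [this, map_sub, cR, cR, hxy l hl, sub_self]
  have key : ∀ d x y, (∀ l : Fin n →₀ ℕ, l.degree < d → x l = y l) → ∀ j,
      ((Ψ y j).subst G - (H y j).subst (Ψ y)) - ((Ψ x j).subst G - (H x j).subst (Ψ x))
      - ((Ψ y j - Ψ x j).subst (diagMap lam) - C (lam j) * (Ψ y j - Ψ x j) - (H y j - H x j))
      ∈ ordIdeal (Fin n) ℂ (d + 1) := by
    intro d x y hxy j
    refine defect_sub_defect hG (hΨ x) (hΨ y) j (hND d x y hxy j) (hRD d x y hxy j) ?_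
    exact subst_sub_subst_mem_ordIdeal (hΨ1 y) (hΨ1 x) (hND d x y hxy) (hH x j) (by omega)
  suffices ∃ x : (Fin n →₀ ℕ) → Fin n → ℂ, ∀ d, ∀ j,
      (Ψ x j).subst G - (H x j).subst (Ψ x) ∈ ordIdeal (Fin n) ℂ d by
    obtain ⟨x, hx⟩ := this
    refine ⟨Ψ x, H x, hΨ x, hH x, fun j => ?_, fun j l h => ?_, fun j l h => ?_⟩
    · exact sub_eq_zero.1 (eq_zero_of_forall_mem_ordIdeal fun d => hx d j)
    · rw [hΨN, cN, if_neg (by tauto)]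
    · rw [hHR, cR, if_neg (by tauto)]
  have hcongr : ∀ d x y, (∀ j, (Ψ x j).subst G - (H x j).subst (Ψ x) ∈ ordIdeal (Fin n) ℂ d) →
      (∀ l : Fin n →₀ ℕ, l.degree < d → x l = y l) →
      ∀ j, (Ψ y j).subst G - (H y j).subst (Ψ y) ∈ ordIdeal (Fin n) ℂ d := by
    intro d x y hx hxy j
    have h1 := ordIdeal_anti (Nat.le_succ d) (key d x y hxy j)
    have h2 := hx j
    have h3 := hND d x y hxy j
    have h4 := subst_mem_ordIdeal (diagMap_mem_ordIdeal lam) h3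
    have h5 := Ideal.mul_mem_left _ (C (lam j)) h3
    have h6 := hRD d x y hxy j
    have := add_mem (add_mem h1 h2) (sub_mem (sub_mem h4 h5) h6)
    convert this using 1
    ring
  refine exists_forall_of_approx Finsupp.degree _ ?_ ?_ (fun _ _ => 0) ?_
  · exact hcongr
  · intro d x hx
    rcases Nat.lt_or_ge d 2 with hd | hd
    · exact ⟨x, fun _ _ => rfl, fun j => ordIdeal_anti (by omega) (hE2 x j)⟩
    let e : (Fin n →₀ ℕ) → Fin n → ℂ := fun l j =>
      coeff l ((Ψ x j).subst G - (H x j).subst (Ψ x))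
    let y : (Fin n →₀ ℕ) → Fin n → ℂ := fun l j =>
      if l.degree = d then
        if lam j = ∏ i, lam i ^ l i then x l j + e l j
        else x l j - e l j / ((∏ i, lam i ^ l i) - lam j)
      else x l j
    have hxy : ∀ l : Fin n →₀ ℕ, l.degree < d → x l = y l := by
      intro l hl
      funext j
      simp only [y, if_neg hl.ne]
    refine ⟨y, hxy, fun j l hl => ?_⟩
    rcases Nat.lt_or_ge l.degree d with hld | hld
    · exact hcongr d x y hx hxy j l hld
    · have hld' : l.degree = d := by omega
      have h1 := key d x y hxy j l hl
      have h2 : Ψ y j - Ψ x j = N y j - N x j := by rw [← hΨN, ← hΨN]; ring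
      have h3 : H y j - H x j = R y j - R x j := by rw [← hHR, ← hHR]; ring
      rw [h2, h3] at h1
      have he : e l j = coeff l ((Ψ x j).subst G) - coeff l ((H x j).subst (Ψ x)) :=
        map_sub _ _ _
      simp only [map_sub, coeff_subst_diagMap, coeff_C_mul, cN, cR, ← he] at h1 ⊢
      by_cases hres : lam j = ∏ i, lam i ^ l i
      · rw [if_neg (by tauto), if_neg (by tauto), if_pos ⟨by omega, hres⟩,
          if_pos ⟨by omega, hres⟩] at h1
        simp only [y, if_pos hld', if_pos hres] at h1
        linear_combination h1
      · rw [if_pos ⟨by omega, hres⟩, if_pos ⟨by omega, hres⟩, if_neg (by tauto),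
          if_neg (by tauto)] at h1
        simp only [y, if_pos hld', if_neg hres] at h1
        have hne : (∏ i, lam i ^ l i) - lam j ≠ 0 := sub_ne_zero.2 (Ne.symm hres)
        have : e l j / ((∏ i, lam i ^ l i) - lam j) * ((∏ i, lam i ^ l i) - lam j) = e l j :=
          div_mul_cancel₀ _ hne
        linear_combination h1 - this
  · intro j l hl
    omega

/-- A Poincaré–Dulac normal form inherits the leading resonant part `λ_j z_j + f` of the
`j`-th component. -/
theorem sub_mem_ordIdeal_of_leading (hG : ∀ j, G j - diagMap lam j ∈ ordIdeal (Fin n) ℂ 2)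
    {Ψ H : FormalMap n} (hΨ : ∀ j, Ψ j - X j ∈ ordIdeal (Fin n) ℂ 2)
    (hH : ∀ j, H j - diagMap lam j ∈ ordIdeal (Fin n) ℂ 2)
    (hconj : ∀ j, (Ψ j).subst G = (H j).subst Ψ)
    (hΨres : ∀ j l, lam j = ∏ i, lam i ^ l i → coeff l (Ψ j - X j) = 0)
    (hHres : ∀ j l, lam j ≠ ∏ i, lam i ^ l i → coeff l (H j - diagMap lam j) = 0)
    {q : ℕ} (hq : 1 ≤ q) {j : Fin n} {f : MvPowerSeries (Fin n) ℂ}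
    (hf : f ∈ ordIdeal (Fin n) ℂ q)
    (hfres : ∀ l, lam j ≠ ∏ i, lam i ^ l i → coeff l f = 0)
    (hGj : G j - (diagMap lam j + f) ∈ ordIdeal (Fin n) ℂ (q + 1)) :
    H j - (diagMap lam j + f) ∈ ordIdeal (Fin n) ℂ (q + 1) := by
  have hΨ1 := fun i => mem_ordIdeal_one_of_sub (hΨ i) (X_mem_ordIdeal i)
  have sG := hasSubst_of_mem_ordIdeal
    fun i => mem_ordIdeal_one_of_sub (hG i) (diagMap_mem_ordIdeal lam i)
  have hf2 : f ∈ ordIdeal (Fin n) ℂ 2 := by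
    have := sub_mem (hG j) (ordIdeal_anti (by omega) hGj)
    simpa using this
  suffices ∀ d, 2 ≤ d → d ≤ q + 1 → Ψ j - X j ∈ ordIdeal (Fin n) ℂ d ∧
      H j - (diagMap lam j + f) ∈ ordIdeal (Fin n) ℂ d from (this (q + 1) (by omega) le_rfl).2
  intro d hd
  induction d, hd using Nat.le_induction with
  | base =>
    intro _
    refine ⟨hΨ j, ?_⟩
    have := sub_mem (hH j) hf2
    rwa [sub_sub] at this
  | succ d hd ih =>
    intro hdq
    obtain ⟨hD, hR⟩ := ih (by omega)
    -- Compare the exact conjugation `(Ψ, H_j)`, of zero defect, with the trial pair `(id, λ_j z_j +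
    -- f)`, of defect `G_j - λ_j z_j - f`.
    have h1 := defect_sub_defect hG (Ψ := (X : FormalMap n)) (Ψ' := Ψ) (by simp) hΨ j hD hR (by
      rw [add_sub_cancel_left]
      exact ordIdeal_anti (by omega) (subst_sub_subst_mem_ordIdeal (c := q + 1) hΨ1 X_mem_ordIdeal
        hΨ hf (by omega)))
    rw [hconj, sub_self, zero_sub, subst_X sG, subst_self, id] at h1
    have h2 := add_mem h1 (ordIdeal_anti (by omega : d + 1 ≤ q + 1) hGj)
    have h3 : ∀ l : Fin n →₀ ℕ, l.degree < d + 1 →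
        coeff l (Ψ j - X j) = 0 ∧ coeff l (H j - (diagMap lam j + f)) = 0 := by
      intro l hl
      have h4 := h2 l hl
      rw [map_add, map_sub, map_neg, map_sub _ (_ - _) (H j - _), map_sub _ (subst _ _),
        coeff_subst_diagMap, coeff_C_mul] at h4
      -- The homological equation links the two coefficients; the normalisation kills one of them,
      -- hence also the other.
      by_cases hres : lam j = ∏ i, lam i ^ l i
      · have h5 := hΨres j l hres
        rw [h5] at h4
        exact ⟨h5, by linear_combination h4⟩
      · have h5 : coeff l (H j - (diagMap lam j + f)) = 0 := by
          rw [← sub_sub, map_sub, hHres j l hres, hfres l hres, sub_zero]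
        rw [h5] at h4
        refine ⟨?_, h5⟩
        have h6 : ((∏ i, lam i ^ l i) - lam j) * coeff l (Ψ j - X j) = 0 := by
          linear_combination -h4
        exact (mul_eq_zero.1 h6).resolve_left (sub_ne_zero.2 (Ne.symm hres))
    exact ⟨fun l hl => (h3 l hl).1, fun l hl => (h3 l hl).2⟩

end PoincareDulac

/-! ### Substitution by maps tangent to the identity -/

section Tangent

variable {n : ℕ} {Ψ : FormalMap n}

theorem subst_sub_self_mem_ordIdeal (hΨ : ∀ j, Ψ j - X j ∈ ordIdeal (Fin n) ℂ 2) {d : ℕ}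
    {f : MvPowerSeries (Fin n) ℂ} (hf : f ∈ ordIdeal (Fin n) ℂ d) :
    f.subst Ψ - f ∈ ordIdeal (Fin n) ℂ (d + 1) := by
  have hΨ1 := fun i => mem_ordIdeal_one_of_sub (hΨ i) (X_mem_ordIdeal i)
  have := subst_sub_subst_mem_ordIdeal (c := d + 1) hΨ1 X_mem_ordIdeal hΨ hf (by omega)
  rwa [subst_self, id] at this

theorem eq_zero_of_subst_eq_zero (hΨ : ∀ j, Ψ j - X j ∈ ordIdeal (Fin n) ℂ 2)
    {f : MvPowerSeries (Fin n) ℂ} (hf : f.subst Ψ = 0) : f = 0 := by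
  refine eq_zero_of_forall_mem_ordIdeal fun d => ?_
  induction d with
  | zero => intro l hl; omega
  | succ d ih =>
    have := subst_sub_self_mem_ordIdeal hΨ ih
    rw [hf, zero_sub] at this
    simpa using neg_mem this

/-- Substituting `Ψ` preserves leading terms, so adding the error `f - g ∘ Ψ` to `g` improves the
order by one. This stands in for an explicit `Ψ⁻¹`. -/
theorem exists_subst_eq (hΨ : ∀ j, Ψ j - X j ∈ ordIdeal (Fin n) ℂ 2)
    (f : MvPowerSeries (Fin n) ℂ) : ∃ g : MvPowerSeries (Fin n) ℂ, g.subst Ψ = f := by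
  have hΨ1 := fun i => mem_ordIdeal_one_of_sub (hΨ i) (X_mem_ordIdeal i)
  have sΨ := hasSubst_of_mem_ordIdeal hΨ1
  suffices ∃ g : MvPowerSeries (Fin n) ℂ, ∀ d, f - g.subst Ψ ∈ ordIdeal (Fin n) ℂ d by
    obtain ⟨g, hg⟩ := this
    exact ⟨g, (sub_eq_zero.1 (eq_zero_of_forall_mem_ordIdeal hg)).symm⟩
  refine exists_forall_of_approx Finsupp.degree
    (fun d (g : MvPowerSeries (Fin n) ℂ) => f - g.subst Ψ ∈ ordIdeal (Fin n) ℂ d) ?_ ?_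
    (0 : MvPowerSeries (Fin n) ℂ) ?_
  · intro d (x : MvPowerSeries (Fin n) ℂ) (y : MvPowerSeries (Fin n) ℂ) hx hxy
    have h1 : x - y ∈ ordIdeal (Fin n) ℂ d := fun l hl => by
      rw [map_sub, sub_eq_zero]; exact hxy l hl
    have h2 := add_mem hx (subst_mem_ordIdeal hΨ1 h1)
    rw [subst_sub sΨ] at h2
    simpa using h2
  · intro d (x : MvPowerSeries (Fin n) ℂ) hx
    refine ⟨x + (f - x.subst Ψ), fun l hl => ?_, ?_⟩
    · have h1 := hx l hl
      have h2 : coeff l x = coeff l (x + (f - x.subst Ψ)) := by rw [map_add, h1, add_zero]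
      exact h2
    · have h1 := neg_mem (subst_sub_self_mem_ordIdeal hΨ hx)
      change f - (x + (f - x.subst Ψ)).subst Ψ ∈ _
      rw [subst_add sΨ]
      convert h1 using 1
      ring
  · intro l hl; omega

theorem comp_assoc {A B D : FormalMap n} (hB : ∀ j, B j ∈ ordIdeal (Fin n) ℂ 1)
    (hD : ∀ j, D j ∈ ordIdeal (Fin n) ℂ 1) : (A.comp B).comp D = A.comp (B.comp D) := by
  funext j
  exact subst_comp_subst_apply (hasSubst_of_mem_ordIdeal hB) (hasSubst_of_mem_ordIdeal hD) (A j)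

theorem FormallyConjugate.trans_of_sub_X_mem {A B D : FormalMap n} (h : FormallyConjugate A B)
    (hA : ∀ j, A j ∈ ordIdeal (Fin n) ℂ 1) (hB : ∀ j, B j ∈ ordIdeal (Fin n) ℂ 1)
    (hΨ : ∀ j, Ψ j - X j ∈ ordIdeal (Fin n) ℂ 2) (hc : Ψ.comp B = D.comp Ψ) :
    FormallyConjugate A D := by
  obtain ⟨Φ, ⟨hΦ0, hΦ1⟩, hΦ⟩ := h
  have hΨ1 := fun i => mem_ordIdeal_one_of_sub (hΨ i) (X_mem_ordIdeal i)
  have hΦ' : ∀ j, Φ j ∈ ordIdeal (Fin n) ℂ 1 := fun j => mem_ordIdeal_one.2 (hΦ0 j)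
  refine ⟨Ψ.comp Φ, ⟨fun j => mem_ordIdeal_one.1 (subst_mem_ordIdeal hΦ' (hΨ1 j)), ?_⟩, ?_⟩
  · have : (Ψ.comp Φ).linearPart = Φ.linearPart := by
      ext j i
      have h1 := subst_mem_ordIdeal hΦ' (hΨ j)
      rw [subst_sub (hasSubst_of_mem_ordIdeal hΦ'), subst_X (hasSubst_of_mem_ordIdeal hΦ')] at h1
      have h2 := h1 (Finsupp.single i 1) (by simp)
      rw [map_sub, sub_eq_zero] at h2
      exact h2
    rwa [this]
  · rw [comp_assoc hΦ' hA, hΦ, ← comp_assoc hB hΦ', hc, comp_assoc hΨ1 hΦ']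

/-- If `g ∘ Ψ = f`, where `Ψ` commutes with `diag(lam)` and `f ∘ diag(lam) = c f`, then
`g ∘ diag(lam) = c g`. -/
theorem subst_diagMap_eq_of_subst_eq {lam : Fin n → ℂ}
    (hΨ : ∀ j, Ψ j - X j ∈ ordIdeal (Fin n) ℂ 2)
    (hcomm : ∀ j, (Ψ j).subst (diagMap lam) = C (lam j) * Ψ j) {f g : MvPowerSeries (Fin n) ℂ}
    (hgf : g.subst Ψ = f) {c : ℂ} (hf : f.subst (diagMap lam) = C c * f) :
    g.subst (diagMap lam) = C c * g := by
  have hΨ1 := fun i => mem_ordIdeal_one_of_sub (hΨ i) (X_mem_ordIdeal i)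
  have sΨ := hasSubst_of_mem_ordIdeal hΨ1
  have sD := hasSubst_of_mem_ordIdeal (diagMap_mem_ordIdeal lam)
  refine sub_eq_zero.1 (eq_zero_of_subst_eq_zero hΨ ?_)
  have h1 : (fun j => (diagMap lam j).subst Ψ) = fun j => (Ψ j).subst (diagMap lam) := by
    funext j
    rw [hcomm, diagMap, subst_mul sΨ, subst_C, subst_X sΨ]
  rw [subst_sub sΨ, subst_mul sΨ, subst_C, subst_comp_subst_apply sD sΨ, h1,
    ← subst_comp_subst_apply sΨ sD, hgf, hf, sub_self]

end Tangent

/-! ### Series in the single monomial `z^α` -/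

section Monomial

variable {n : ℕ} {α : Fin n →₀ ℕ}

theorem hasSubst_monomial (hα : α ≠ 0) :
    PowerSeries.HasSubst (monomial α (1 : ℂ)) := PowerSeries.HasSubst.monomial hα 1

theorem monomial_one_pow (α : Fin n →₀ ℕ) (s : ℕ) :
    (monomial α (1 : ℂ)) ^ s = monomial (s • α) 1 := by
  rw [monomial_pow, one_pow]

theorem smul_left_injective_of_ne_zero (hα : α ≠ 0) :
    Function.Injective fun s : ℕ => s • α := by
  intro s t hst
  obtain ⟨i, hi⟩ := Finsupp.ne_iff.1 hα
  have := DFunLike.congr_fun hst i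
  have hi' : α i ≠ 0 := by simpa using hi
  simpa [hi'] using this

theorem coeff_smul_subst_monomial (hα : α ≠ 0) (h : PowerSeries ℂ) (s : ℕ) :
    coeff (s • α) (h.subst (monomial α (1 : ℂ))) = PowerSeries.coeff s h := by
  classical
  rw [PowerSeries.coeff_subst (hasSubst_monomial hα), finsum_eq_single _ s]
  · rw [monomial_one_pow, coeff_monomial_same, smul_eq_mul, mul_one]
  · intro t ht
    rw [monomial_one_pow, coeff_monomial_ne, smul_zero]
    exact fun h => ht (smul_left_injective_of_ne_zero hα h).symm

theorem coeff_subst_monomial_eq_zero (hα : α ≠ 0) (h : PowerSeries ℂ) {l : Fin n →₀ ℕ}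
    (hl : ∀ s : ℕ, l ≠ s • α) : coeff l (h.subst (monomial α (1 : ℂ))) = 0 := by
  classical
  rw [PowerSeries.coeff_subst (hasSubst_monomial hα)]
  refine finsum_eq_zero_of_forall_eq_zero fun t => ?_
  rw [monomial_one_pow, coeff_monomial_ne (hl t), smul_zero]

/-- A series whose monomials are among the `z ^ (s α) z_j` is `z_j` times a series in `z ^ α`. -/
theorem eq_X_mul_subst_monomial (hα : α ≠ 0) (j : Fin n) (f : MvPowerSeries (Fin n) ℂ)
    (hf : ∀ l, coeff l f ≠ 0 → ∃ s : ℕ, l = s • α + Finsupp.single j 1) :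
    f = X j * (PowerSeries.mk fun s => coeff (s • α + Finsupp.single j 1) f).subst
      (monomial α (1 : ℂ)) := by
  classical
  ext l
  rw [X, coeff_monomial_mul]
  split_ifs with hl
  · rw [one_mul]
    by_cases h : ∃ s : ℕ, l - Finsupp.single j 1 = s • α
    · obtain ⟨s, hs⟩ := h
      rw [hs, coeff_smul_subst_monomial hα, PowerSeries.coeff_mk, ← hs, tsub_add_cancel_of_le hl]
    · rw [coeff_subst_monomial_eq_zero hα _ (fun s hs => h ⟨s, hs⟩)]
      by_contra hne
      obtain ⟨s, hs⟩ := hf l hne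
      exact h ⟨s, by rw [hs, add_tsub_cancel_right]⟩
  · by_contra hne
    obtain ⟨s, hs⟩ := hf l hne
    exact hl (by rw [hs]; exact le_add_self)

theorem C_mul_monomial_mul_X (k : Fin n →₀ ℕ) (c : ℂ) (j : Fin n) :
    C c * monomial k 1 * X j = monomial (k + Finsupp.single j 1) c := by
  rw [X, ← monomial_zero_eq_C_apply, monomial_mul_monomial, monomial_mul_monomial]
  simp

theorem subst_powerSeries_subst {a : MvPowerSeries (Fin n) ℂ} (ha : PowerSeries.HasSubst a)
    {K : FormalMap n} (hK : HasSubst K) (p : PowerSeries ℂ) :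
    (p.subst a).subst K = p.subst (a.subst K) :=
  subst_comp_subst_apply ha.const hK p

variable {m : ℕ} (hmn : m ≤ n)

theorem prod_eq_prod_castLE {M : Type*} [CommMonoid M] (f : Fin n → M)
    (hf : ∀ i : Fin n, m ≤ (i : ℕ) → f i = 1) : ∏ i, f i = ∏ j, f (Fin.castLE hmn j) := by
  symm
  refine Fintype.prod_of_injective (Fin.castLE hmn) (Fin.castLE_injective hmn) _ _ ?_
    fun _ => rfl
  intro i hi
  refine hf i ?_
  by_contra h
  exact hi ⟨⟨i, by omega⟩, rfl⟩

/-- The action on `z ^ α` of a formal map whose components are `z_j k_j(z ^ α)` for `j < m`. -/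
theorem subst_monomial_of_eq_X_mul (hα : α ≠ 0) (hαm : ∀ i : Fin n, m ≤ (i : ℕ) → α i = 0)
    {K : FormalMap n} (hK : HasSubst K) {k : Fin m → PowerSeries ℂ}
    (hKk : ∀ j, K (Fin.castLE hmn j)
      = X (Fin.castLE hmn j) * (k j).subst (monomial α (1 : ℂ))) :
    (monomial α (1 : ℂ)).subst K
      = (PowerSeries.X * ∏ j, k j ^ α (Fin.castLE hmn j)).subst (monomial α (1 : ℂ)) := by
  have su := hasSubst_monomial hα
  have hu : (monomial α (1 : ℂ)) = ∏ j : Fin m, X (Fin.castLE hmn j) ^ α (Fin.castLE hmn j) := by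
    rw [monomial_one_eq, Finsupp.prod_fintype _ _ (by simp),
      prod_eq_prod_castLE hmn _ fun i hi => by rw [hαm i hi, pow_zero]]
  have h1 : (monomial α (1 : ℂ)).subst K
      = ∏ j : Fin m, K (Fin.castLE hmn j) ^ α (Fin.castLE hmn j) := by
    rw [subst_monomial hK, map_one, one_mul, Finsupp.prod_fintype _ _ (by simp),
      prod_eq_prod_castLE hmn _ fun i hi => by rw [hαm i hi, pow_zero]]
  rw [h1, PowerSeries.subst_mul su, PowerSeries.subst_X su, ← PowerSeries.coe_substAlgHom su,
    map_prod, PowerSeries.coe_substAlgHom su]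
  conv_rhs => lhs; rw [hu]
  rw [← Finset.prod_mul_distrib]
  refine Finset.prod_congr rfl fun j _ => ?_
  rw [hKk, mul_pow, ← PowerSeries.coe_substAlgHom su, map_pow]

end Monomial

/-! ### From the germ to its formal data -/

theorem IsDiffGerm.eigenvalue_ne_zero {n : ℕ} {F : (Fin n → ℂ) → (Fin n → ℂ)} {lam : Fin n → ℂ}
    (hF : IsDiffGerm F) (hdiag : HasDiagonalDifferential F lam) (j : Fin n) : lam j ≠ 0 := by
  intro h0
  obtain ⟨hFa, hF0, G, hGa, -, hGF, -⟩ := hF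
  have hF' := hFa.differentiableAt.hasFDerivAt
  have hG' : HasFDerivAt G (fderiv ℂ G 0) (F 0) := by
    rw [hF0]; exact hGa.differentiableAt.hasFDerivAt
  have h1 := hG'.comp 0 hF'
  have h2 : HasFDerivAt (G ∘ F) (ContinuousLinearMap.id ℂ (Fin n → ℂ)) 0 :=
    (hasFDerivAt_id 0).congr_of_eventuallyEq hGF
  have h3 := h1.unique h2
  have h4 : fderiv ℂ F 0 (Pi.single j 1) = 0 := by
    funext i
    rw [hdiag]
    by_cases hij : i = j
    · simp [hij, h0]
    · simp [hij]
  have h5 := congrFun (DFunLike.congr_fun h3 (Pi.single j 1)) j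
  simp [h4] at h5

/-- Beyond the given conjugacy to `G`, this is all that the argument needs to know about the Taylor
series. -/
theorem constantCoeff_taylor {n : ℕ} (F : (Fin n → ℂ) → (Fin n → ℂ)) (j : Fin n) :
    constantCoeff (taylor F j) = F 0 j := by
  have h : ∀ (L : List (Fin n)) (f : (Fin n → ℂ) → ℂ),
      L.foldr (fun i g => (partialDeriv i)^[(0 : Fin n →₀ ℕ) i] g) f = f := by
    intro L f
    induction L with
    | nil => rfl
    | cons a L ih => rw [List.foldr_cons, ih]; rfl
  rw [← coeff_zero_eq_constantCoeff_apply]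
  change iteratedPartialDeriv 0 (fun z => F z j) 0 / ∏ i, (((0 : Fin n →₀ ℕ) i).factorial : ℂ) = _
  rw [iteratedPartialDeriv, h]
  simp

/-! ### Consequences of one-resonance and assembly of the normal form -/

section OneResonance

variable {n m : ℕ} {lam : Fin n → ℂ} {α : Fin n →₀ ℕ}

theorem prod_pow_single (lam : Fin n → ℂ) (j : Fin n) :
    ∏ i, lam i ^ (Finsupp.single j 1 : Fin n →₀ ℕ) i = lam j := by
  rw [Finset.prod_eq_single j]
  · simp
  · intro i _ hi; simp [hi.symm]
  · simp

/-- Cancel `λ_1` in the resonance `(1, α + e_1)`. -/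
theorem IsOneResonant.prod_pow_eq_one (hres : IsOneResonant lam m α) (hm : 1 ≤ m) (hmn : m ≤ n)
    (hlam : ∀ j, lam j ≠ 0) : ∏ i, lam i ^ α i = 1 := by
  classical
  let j : Fin n := ⟨0, by omega⟩
  have h := ((hres.2.2 j (by simp [j]; omega) (1 • α + Finsupp.single j 1)).2
    ⟨1, le_rfl, rfl⟩).2
  simp only [one_smul, Finsupp.add_apply, pow_add, Finset.prod_mul_distrib, prod_pow_single] at h
  exact mul_right_cancel₀ (hlam j) (by rw [one_mul]; exact h.symm)

theorem prod_pow_smul_add_single (h1 : ∏ i, lam i ^ α i = 1) (s : ℕ) (j : Fin n) :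
    ∏ i, lam i ^ (s • α + Finsupp.single j 1 : Fin n →₀ ℕ) i = lam j := by
  classical
  simp only [Finsupp.add_apply, pow_add, Finset.prod_mul_distrib, prod_pow_single, Finsupp.smul_apply,
    smul_eq_mul]
  simp_rw [mul_comm s, pow_mul, Finset.prod_pow, h1, one_pow, one_mul]

theorem coeff_diagMap (lam : Fin n → ℂ) (j : Fin n) (l : Fin n →₀ ℕ) :
    coeff l (diagMap lam j) = if l = Finsupp.single j 1 then lam j else 0 := by
  classical
  rw [diagMap, coeff_C_mul, coeff_X]
  split_ifs <;> simp

variable {H : FormalMap n}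

theorem subst_diagMap_of_resonant
    (hHres : ∀ j l, lam j ≠ ∏ i, lam i ^ l i → coeff l (H j - diagMap lam j) = 0) (j : Fin n) :
    (H j).subst (diagMap lam) = C (lam j) * H j := by
  ext l
  rw [coeff_subst_diagMap, coeff_C_mul]
  by_cases h : lam j = ∏ i, lam i ^ l i
  · rw [← h]
  · have h1 := hHres j l h
    rw [map_sub, coeff_diagMap, if_neg, sub_zero] at h1
    · rw [h1, mul_zero, mul_zero]
    · rintro rfl
      apply h
      exact (prod_pow_single lam j).symm

theorem exists_eq_smul_add_single (hres : IsOneResonant lam m α)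
    (hH : ∀ j, H j - diagMap lam j ∈ ordIdeal (Fin n) ℂ 2)
    (hHres : ∀ j l, lam j ≠ ∏ i, lam i ^ l i → coeff l (H j - diagMap lam j) = 0)
    {j : Fin n} (hj : (j : ℕ) < m) {l : Fin n →₀ ℕ} (hl : coeff l (H j) ≠ 0) :
    ∃ s : ℕ, l = s • α + Finsupp.single j 1 := by
  by_cases hl1 : l = Finsupp.single j 1
  · exact ⟨0, by simpa using hl1⟩
  have h0 : coeff l (H j - diagMap lam j) ≠ 0 := by
    rw [map_sub, coeff_diagMap, if_neg hl1, sub_zero]; exact hl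
  have hdeg : 2 ≤ l.degree := by
    by_contra h
    exact h0 (hH j l (by omega))
  have hr : lam j = ∏ i, lam i ^ l i := by
    by_contra h
    exact h0 (hHres j l h)
  obtain ⟨k, -, hk⟩ := (hres.2.2 j hj l).1 ⟨hdeg, hr⟩
  exact ⟨k, hk⟩

theorem hasOnlyResonantMonomials_of_subst_diagMap {A : FormalMap n} {j : Fin n}
    (hA : A j - diagMap lam j ∈ ordIdeal (Fin n) ℂ 2)
    (hcomm : (A j).subst (diagMap lam) = C (lam j) * A j) :
    HasOnlyResonantMonomials lam A j := by
  have hlow : ∀ l : Fin n →₀ ℕ, l.degree < 2 →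
      coeff l (A j) = if l = Finsupp.single j 1 then lam j else 0 := by
    intro l hl
    have := hA l hl
    rwa [map_sub, coeff_diagMap, sub_eq_zero] at this
  refine ⟨by rw [hlow _ (by simp), if_pos rfl], fun l hl => ?_⟩
  by_cases hdeg : l.degree < 2
  · rw [hlow l hdeg] at hl
    left
    by_contra h
    exact hl (if_neg h)
  · right
    refine ⟨by omega, ?_⟩
    have := congrArg (coeff l) hcomm
    rw [coeff_subst_diagMap, coeff_C_mul] at this
    exact (mul_right_cancel₀ hl this).symm

/-- Each term is `α_j² / |λ_j|²`: the conjugate in the normal form makes `β` transverse to the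
obstruction at `d = r`. -/
theorem sum_sq_div_normSq_ne_zero (hα : α ≠ 0) (hmn : m ≤ n)
    (hαm : ∀ i : Fin n, m ≤ (i : ℕ) → α i = 0) (hlam : ∀ j, lam j ≠ 0) :
    ∑ j : Fin m, (α (Fin.castLE hmn j) * (conj (lam (Fin.castLE hmn j)))⁻¹)
      * (α (Fin.castLE hmn j) : ℂ) / lam (Fin.castLE hmn j) ≠ 0 := by
  have h : ∀ j : Fin m, (α (Fin.castLE hmn j) * (conj (lam (Fin.castLE hmn j)))⁻¹)
      * (α (Fin.castLE hmn j) : ℂ) / lam (Fin.castLE hmn j)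
      = (((α (Fin.castLE hmn j) : ℝ) ^ 2 / Complex.normSq (lam (Fin.castLE hmn j)) : ℝ) : ℂ) := by
    intro j
    push_cast
    rw [Complex.normSq_eq_conj_mul_self]
    have h1 := hlam (Fin.castLE hmn j)
    have h2 : conj (lam (Fin.castLE hmn j)) ≠ 0 := by simpa using h1
    field_simp
  simp_rw [h]
  rw [← Complex.ofReal_sum]
  refine Complex.ofReal_ne_zero.2 (ne_of_gt ?_)
  obtain ⟨i, hi⟩ := Finsupp.ne_iff.1 hα
  have him : (i : ℕ) < m := by
    by_contra h
    exact hi (by simpa using hαm i (by omega))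
  refine Finset.sum_pos' (fun j _ => div_nonneg (sq_nonneg _) (Complex.normSq_nonneg _)) ⟨⟨i, him⟩, Finset.mem_univ _, ?_⟩
  have h1 : 0 < Complex.normSq (lam (Fin.castLE hmn ⟨i, him⟩)) := Complex.normSq_pos.2 (hlam _)
  have h2 : 0 < (α (Fin.castLE hmn ⟨i, him⟩) : ℝ) := by
    have : α i ≠ 0 := by simpa using hi
    exact_mod_cast Nat.pos_of_ne_zero this
  positivity

/-- A map in Poincaré–Dulac normal form whose components of index `< m` are
`z_j h_j(z ^ α)` is conjugate to the final normal form. -/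
theorem exists_conj_of_conjDefect_eq_zero (hmn : m ≤ n) (hα : α ≠ 0)
    (hαm : ∀ i : Fin n, m ≤ (i : ℕ) → α i = 0) (hprod : ∏ i, lam i ^ α i = 1)
    (hH : ∀ j, H j - diagMap lam j ∈ ordIdeal (Fin n) ℂ 2)
    (hHcomm : ∀ j, (H j).subst (diagMap lam) = C (lam j) * H j)
    {h p : Fin m → PowerSeries ℂ}
    (hHh : ∀ j, H (Fin.castLE hmn j)
      = X (Fin.castLE hmn j) * (h j).subst (monomial α (1 : ℂ)))
    {r : ℕ} {c β : Fin m → ℂ} {μ : ℂ} (hp : ∀ j, PowerSeries.constantCoeff (p j) = 1)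
    (hdef : ∀ j, conjDefect r (fun j => α (Fin.castLE hmn j)) (fun j => lam (Fin.castLE hmn j))
      c β h p μ j = 0) :
    ∃ Ψ A : FormalMap n, (∀ j, Ψ j - X j ∈ ordIdeal (Fin n) ℂ 2) ∧ Ψ.comp H = A.comp Ψ ∧
      (∀ j : Fin m, A (Fin.castLE hmn j) =
        C (lam (Fin.castLE hmn j)) * X (Fin.castLE hmn j)
          + C (c j) * monomial (r • α) 1 * X (Fin.castLE hmn j)
          + C (μ * β j) * monomial ((2 * r) • α) 1 * X (Fin.castLE hmn j)) ∧
      (∀ j : Fin n, m ≤ (j : ℕ) → HasOnlyResonantMonomials lam A j) := by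
  have su := hasSubst_monomial hα
  have hH1 := fun i => mem_ordIdeal_one_of_sub (hH i) (diagMap_mem_ordIdeal lam i)
  have sH := hasSubst_of_mem_ordIdeal hH1
  have sD := hasSubst_of_mem_ordIdeal (diagMap_mem_ordIdeal lam)
  set u : MvPowerSeries (Fin n) ℂ := monomial α 1 with hu
  let Ψ : FormalMap n := fun j =>
    if hj : (j : ℕ) < m then X j * (p ⟨j, hj⟩).subst u else X j
  have hΨlt : ∀ j : Fin m, Ψ (Fin.castLE hmn j) = X (Fin.castLE hmn j) * (p j).subst u := by
    intro j
    simp only [Ψ]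
    rw [dif_pos (by simp)]
    rfl
  have hΨge : ∀ j : Fin n, m ≤ (j : ℕ) → Ψ j = X j := by
    intro j hj
    simp only [Ψ]
    rw [dif_neg (by omega)]
  have hΨ : ∀ j, Ψ j - X j ∈ ordIdeal (Fin n) ℂ 2 := by
    intro j
    rcases Nat.lt_or_ge j m with hj | hj
    · have h1 := hΨlt ⟨j, hj⟩
      have h2 : (p ⟨j, hj⟩).subst u - 1 ∈ ordIdeal (Fin n) ℂ 1 := by
        have h3 : (p ⟨j, hj⟩ - 1).subst u = (p ⟨j, hj⟩).subst u - 1 := by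
          rw [← PowerSeries.coe_substAlgHom su, map_sub, map_one]
        rw [← h3, mem_ordIdeal_one]
        refine PowerSeries.constantCoeff_subst_eq_zero ?_ _ (by simp [hp])
        exact mem_ordIdeal_one.1 (monomial_mem_ordIdeal
          (Nat.one_le_iff_ne_zero.2 (by rwa [Ne, Finsupp.degree_eq_zero_iff])) _)
      have h4 := mul_mem_ordIdeal (X_mem_ordIdeal j) h2
      rw [mul_sub, mul_one] at h4
      exact h1 ▸ h4
    · rw [hΨge j hj, sub_self]
      exact zero_mem _
  have hΨ1 := fun i => mem_ordIdeal_one_of_sub (hΨ i) (X_mem_ordIdeal i)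
  have sΨ := hasSubst_of_mem_ordIdeal hΨ1
  have huD : u.subst (diagMap lam) = u := by
    classical
    ext l
    rw [coeff_subst_diagMap, hu, coeff_monomial]
    split_ifs with hl
    · rw [hl, hprod, one_mul]
    · rw [mul_zero]
  have hcomm : ∀ j, (Ψ j).subst (diagMap lam) = C (lam j) * Ψ j := by
    intro j
    rcases Nat.lt_or_ge j m with hj | hj
    · have h1 : Ψ j = X j * (p ⟨j, hj⟩).subst u := hΨlt ⟨j, hj⟩
      rw [h1, subst_mul sD, subst_X sD, subst_powerSeries_subst su sD, huD, diagMap, mul_assoc]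
    · rw [hΨge j hj, subst_X sD, diagMap]
  -- `Y j` plays the role of `H_j ∘ Ψ⁻¹`.
  choose Y hY using fun j => exists_subst_eq hΨ (H j)
  let A : FormalMap n := fun j => if hj : (j : ℕ) < m then
    C (lam j) * X j + C (c ⟨j, hj⟩) * monomial (r • α) 1 * X j
      + C (μ * β ⟨j, hj⟩) * monomial ((2 * r) • α) 1 * X j else Y j
  have hAlt : ∀ j : Fin m, A (Fin.castLE hmn j) =
        C (lam (Fin.castLE hmn j)) * X (Fin.castLE hmn j)
          + C (c j) * monomial (r • α) 1 * X (Fin.castLE hmn j)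
          + C (μ * β j) * monomial ((2 * r) • α) 1 * X (Fin.castLE hmn j) := by
    intro j
    simp only [A]
    rw [dif_pos (by simp)]
    rfl
  have hAge : ∀ j : Fin n, m ≤ (j : ℕ) → A j = Y j := by
    intro j hj
    simp only [A]
    rw [dif_neg (by omega)]
  refine ⟨Ψ, A, hΨ, ?_, hAlt, fun j hj => ?_⟩
  · funext j
    change (Ψ j).subst H = (A j).subst Ψ
    rcases Nat.lt_or_ge j m with hj | hj
    · obtain ⟨i, rfl⟩ : ∃ i : Fin m, j = Fin.castLE hmn i := ⟨⟨j, hj⟩, rfl⟩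
      have hφ := subst_monomial_of_eq_X_mul hmn hα hαm sΨ hΨlt
      have hg := subst_monomial_of_eq_X_mul hmn hα hαm sH hHh
      rw [← hu] at hφ hg
      have hd := sub_eq_zero.1 (hdef i)
      have sg := hasSubst_X_mul (∏ j, h j ^ α (Fin.castLE hmn j))
      generalize PowerSeries.X * ∏ j, h j ^ α (Fin.castLE hmn j) = g at hg hd sg
      generalize PowerSeries.X * ∏ j, p j ^ α (Fin.castLE hmn j) = φ at hφ hd
      -- The `i`-th conjugation equation is `z_i` times the vanishing defect evaluated at `u`.
      have hd' := congrArg (fun q : PowerSeries ℂ => q.subst u) hd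
      simp only [PowerSeries.subst_mul su, PowerSeries.subst_add su, PowerSeries.subst_pow su,
        PowerSeries.subst_C, PowerSeries.subst_comp_subst_apply sg su] at hd'
      rw [hΨlt, subst_mul sH, subst_X sH, subst_powerSeries_subst su sH, hg, hHh, hAlt,
        ← monomial_one_pow, ← monomial_one_pow, ← hu]
      simp only [subst_mul sΨ, subst_add sΨ, subst_pow sΨ, subst_C, subst_X sΨ, hφ, hΨlt]
      linear_combination X (Fin.castLE hmn i) * hd'
    · rw [hΨge j hj, subst_X sH, hAge j hj, hY]
  · refine hasOnlyResonantMonomials_of_subst_diagMap ?_ ?_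
    · rw [hAge j hj]
      have h0 : Y j ∈ ordIdeal (Fin n) ℂ 1 := by
        have h1 := subst_sub_self_mem_ordIdeal hΨ (d := 0) (f := Y j) (fun l hl => by omega)
        rw [hY] at h1
        simpa using sub_mem (hH1 j) h1
      have h1 := subst_sub_self_mem_ordIdeal hΨ h0
      rw [hY] at h1
      convert sub_mem (hH j) h1 using 1
      ring
    · rw [hAge j hj]
      exact subst_diagMap_eq_of_subst_eq hΨ hcomm (hY j) (hHcomm j)

/-- Existence of the normal form for a formal map with a non-degenerate leading form. -/
theorem exists_normalForm (hm : 1 ≤ m) (hmn : m ≤ n) (hlam : ∀ j, lam j ≠ 0)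
    (hres : IsOneResonant lam m α) {r : ℕ} (hr : 1 ≤ r) {c : Fin m → ℂ} {G B : FormalMap n}
    (hG : HasLeadingForm hmn lam α r c G)
    (hΛ : ∑ j : Fin m, c j * (α (Fin.castLE hmn j) : ℂ) / lam (Fin.castLE hmn j) ≠ 0)
    (hB : ∀ j, constantCoeff (B j) = 0) (hBG : FormallyConjugate B G) :
    ∃ (μ : ℂ) (A : FormalMap n), FormallyConjugate B A ∧
      (∀ j : Fin m, A (Fin.castLE hmn j) =
        C (lam (Fin.castLE hmn j)) * X (Fin.castLE hmn j)
          + C (c j) * monomial (r • α) 1 * X (Fin.castLE hmn j)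
          + C (μ * (α (Fin.castLE hmn j) : ℂ) * (conj (lam (Fin.castLE hmn j)))⁻¹)
              * monomial ((2 * r) • α) 1 * X (Fin.castLE hmn j)) ∧
      (∀ j : Fin n, m ≤ (j : ℕ) → HasOnlyResonantMonomials lam A j) := by
  classical
  obtain ⟨hα, hαm, -⟩ := id hres
  have hprod := hres.prod_pow_eq_one hm hmn hlam
  obtain ⟨hG0, hG1, hGlead⟩ := hG
  have hG2 := sub_diagMap_mem_ordIdeal hG0 hG1
  obtain ⟨Ψ, H, hΨ, hH, hconj, hΨres, hHres⟩ := exists_poincareDulac hG2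
  have hH1 := fun i => mem_ordIdeal_one_of_sub (hH i) (diagMap_mem_ordIdeal lam i)
  have hBH : FormallyConjugate B H := hBG.trans_of_sub_X_mem
    (fun j => mem_ordIdeal_one.2 (hB j)) (fun j => mem_ordIdeal_one.2 (hG0 j)) hΨ (funext hconj)
  have hlead : ∀ j : Fin m, H (Fin.castLE hmn j) - (diagMap lam (Fin.castLE hmn j)
      + monomial (r • α + Finsupp.single (Fin.castLE hmn j) 1) (c j))
      ∈ ordIdeal (Fin n) ℂ (r * α.degree + 2) := by
    intro j
    refine sub_mem_ordIdeal_of_leading hG2 hΨ hH hconj hΨres hHres (q := r * α.degree + 1)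
      (by omega) (monomial_mem_ordIdeal (by simp) _) ?_ ?_
    · intro l hl
      refine coeff_monomial_ne ?_ _
      rintro rfl
      exact hl (prod_pow_smul_add_single hprod r _).symm
    · intro l hl
      rw [map_sub, hGlead j l hl, C_mul_monomial_mul_X, diagMap, sub_self]
  let h : Fin m → PowerSeries ℂ := fun j =>
    PowerSeries.mk fun s => coeff (s • α + Finsupp.single (Fin.castLE hmn j) 1)
      (H (Fin.castLE hmn j))
  have hHh : ∀ j, H (Fin.castLE hmn j)
      = X (Fin.castLE hmn j) * (h j).subst (monomial α (1 : ℂ)) := fun j =>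
    eq_X_mul_subst_monomial hα _ _ fun l hl =>
      exists_eq_smul_add_single hres hH hHres (by simp) hl
  have hh : ∀ j, (PowerSeries.X : PowerSeries ℂ) ^ (r + 1) ∣
      h j - PowerSeries.C (lam (Fin.castLE hmn j)) - PowerSeries.C (c j) * PowerSeries.X ^ r := by
    intro j
    refine PowerSeries.X_pow_dvd_iff.2 fun s hs => ?_
    -- For `s ≤ r` the monomial `z^(sα) z_j` has degree `s|α| + 1 < r|α| + 2`, inside the range
    -- controlled by `hlead`.
    have hsr : s * α.degree ≤ r * α.degree := Nat.mul_le_mul_right _ (by omega)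
    have h1 := hlead j (s • α + Finsupp.single (Fin.castLE hmn j) 1) (by simp; omega)
    have h2 : (s • α + Finsupp.single (Fin.castLE hmn j) 1 = Finsupp.single (Fin.castLE hmn j) 1)
        ↔ s = 0 := by simp [hα]
    have h3 : (s • α + Finsupp.single (Fin.castLE hmn j) 1
        = r • α + Finsupp.single (Fin.castLE hmn j) 1) ↔ s = r :=
      ⟨fun h => smul_left_injective_of_ne_zero hα (add_right_cancel h), fun h => by rw [h]⟩
    rw [map_sub, map_add, coeff_diagMap, coeff_monomial] at h1
    simp only [h2, h3] at h1
    rw [map_sub, map_sub, PowerSeries.coeff_C, PowerSeries.coeff_C_mul, PowerSeries.coeff_X_pow,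
      PowerSeries.coeff_mk, mul_ite, mul_one, mul_zero, sub_sub]
    exact h1
  have hprod' : ∏ j : Fin m, lam (Fin.castLE hmn j) ^ α (Fin.castLE hmn j) = 1 := by
    rw [← prod_eq_prod_castLE hmn (fun i => lam i ^ α i) fun i hi => by rw [hαm i hi, pow_zero],
      hprod]
  obtain ⟨p, μ, hp, hdef⟩ := exists_conjDefect_eq_zero
    (β := fun j : Fin m => α (Fin.castLE hmn j) * (conj (lam (Fin.castLE hmn j)))⁻¹) hr
    (fun j => hlam (Fin.castLE hmn j)) hprod' hh hΛ (sum_sq_div_normSq_ne_zero hα hmn hαm hlam)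
  obtain ⟨Φ, A, hΦ, hΦA, hAlt, hAge⟩ := exists_conj_of_conjDefect_eq_zero hmn hα hαm hprod hH
    (subst_diagMap_of_resonant hHres) hHh hp hdef
  refine ⟨μ, A, hBH.trans_of_sub_X_mem (fun j => mem_ordIdeal_one.2 (hB j)) hH1 hΦ hΦA,
    fun j => ?_, hAge⟩
  rw [hAlt, mul_assoc μ]

end OneResonance

end OneResonant

theorem theorem3p6 {n m : ℕ} (hm : 1 ≤ m) (hmn : m ≤ n)
    (F : (Fin n → ℂ) → (Fin n → ℂ)) (lam : Fin n → ℂ) (α : Fin n →₀ ℕ)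
    (hF : OneResonant.IsDiffGerm F)
    (hdiag : OneResonant.HasDiagonalDifferential F lam)
    (hres : OneResonant.IsOneResonant lam m α)
    (hnd : OneResonant.IsNonDegenerate hmn F lam α) :
    ∃ (k : ℕ) (μ : ℂ) (a : Fin m → ℂ) (Fhat : OneResonant.FormalMap n),
      1 ≤ k ∧
      OneResonant.FormallyConjugate (OneResonant.taylor F) Fhat ∧
      (∀ j : Fin m, Fhat (Fin.castLE hmn j) =
        C (lam (Fin.castLE hmn j)) * X (Fin.castLE hmn j)
          + C (a j) * monomial (k • α) 1 * X (Fin.castLE hmn j)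
          + C (μ * (α (Fin.castLE hmn j) : ℂ) * (conj (lam (Fin.castLE hmn j)))⁻¹)
              * monomial ((2 * k) • α) 1 * X (Fin.castLE hmn j)) ∧
      (∀ j : Fin n, m ≤ (j : ℕ) → OneResonant.HasOnlyResonantMonomials lam Fhat j) := by
  obtain ⟨G, r, c, hFG, hr, -, hG, hΛ⟩ := hnd
  obtain ⟨μ, A, hFA, hAlt, hAge⟩ := OneResonant.exists_normalForm hm hmn
    (hF.eigenvalue_ne_zero hdiag) hres hr hG hΛ
    (fun j => by rw [OneResonant.constantCoeff_taylor, hF.2.1]; rfl) hFG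
  exact ⟨r, μ, c, A, hr, hFA, hAlt, hAge⟩
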